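/- **Setting.** All Hilbert spaces are finite dimensional, each with a fixed computational basis $\{|l\rangle\}$. Let $|\psi\rangle^{RAB}\in\mathcal H^R\otimes\mathcal H^A\otimes\mathcal H^B$ be a unit vector, and let $\psi^{R},\psi^{B},\psi^{AB}$ be the reduced states of $|\psi\rangle\langle\psi|^{RAB}$. For a positive integer $K$ let $|\Phi_K^+\rangle=\frac1{\sqrt K}\sum_{l=0}^{K-1}|l\rangle\otimes|l\rangle$. Let $\mathcal H^{B'}$ be a copy of $\mathcal H^A$. An *LOCC map* between two parties is a completely positive trace-preserving map achieved by local operations and classical communication: each party may add auxiliary systems; in each round one of the parties performs a measurement (with finitely many outcomes) on its own system, which may depend on all the outcomes obtained before, and broadcasts the outcome; after $r$ rounds each party performs a final local measurement that may depend on all the broadcast outcomes, and the outcomes are erased. LOCC maps are the maps so obtained in finitely many rounds, together with the limits for $r\to\infty$ of the maps obtained from such protocols with $r=1,2,\ldots$ rounds, where (apart from the final local measurements) each protocol extends the previous one by one round. The communication may go in either direction in each round; one-way LOCC is a special case. A *protocol for exact state merging* of $|\psi\rangle^{RAB}$ consists of positive integers $K,L$, systems $\mathcal H^{\overline A},\mathcal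 H^{\overline B}$ of dimension at least $\max(K,L)$, and an LOCC map $\mathcal M$ from the parties' systems $\mathcal H^A\otimes\mathcal H^{\overline A}$ (sender) and $\mathcal H^B\otimes\mathcal H^{\overline B}$ (receiver) to $\mathcal H^{\overline A}$ (sender) and $\mathcal H^{B'}\otimes\mathcal H^B\otimes\mathcal H^{\overline B}$ (receiver), such that $$\mathrm{id}^R\otimes\mathcal M\left(\psi^{RAB}\otimes{\Phi_K^+}^{\overline A\,\overline B}\right)=\psi^{RB'B}\otimes{\Phi_L^+}^{\overline A\,\overline B}.$$ Its entanglement cost is $\log_2K-\log_2L$. The protocol is *non-catalytic* if $L=1$; its cost is then $\log_2 K$. For Hermitian operators, $X\prec Y$ (majorization) means that $X=\sum_jp(j)\,U_jYU_j^\dagger$ for a finite probability distribution $p$ and unitary operators $U_j$; if $X$ and $Y$ act on different spaces, both are first extended by zero to a common space (for instance the direct sum of the two), i.e. their spectra are padded with zeros. **Theorem.** (i) For every protocol for exact state merging of $|\psi\rangle^{RAB}$, with integers $K,L$, $$\log_2K-\log_2L\ \geq\ \inf\left\{\log_2K'-\log_2L' : K',L'\in\{1,2,\ldots\},\ \frac{\mathbb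 1_{K'}}{K'}\otimes\psi^B\prec\frac{\mathbb 1_{L'}}{L'}\otimes\psi^{AB}\right\},$$ where the set on the right-hand side is non-empty and bounded below. (ii) For every non-catalytic protocol for exact state merging of $|\psi\rangle^{RAB}$, $$\log_2K\ \geq\ \min\left\{\log_2K' : K'\in\{1,2,\ldots\},\ \frac{\mathbb 1_{K'}}{K'}\otimes\psi^B\prec\psi^{AB}\right\},$$ where the minimum is attained. **Corollary.** Suppose that $\psi^R=\mathbb 1^R/D$, and let $\lambda_0^B$ be the largest eigenvalue of $\psi^B$. Then every protocol for exact state merging of $|\psi\rangle^{RAB}$ satisfies $$\log_2K-\log_2L\ \geq\ \log_2\left(\lambda_0^BD\right),$$ and every non-catalytic one satisfies $$\log_2K\ \geq\ \log_2\left\lceil\lambda_0^BD\right\rceil .$$ -/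

import Mathlib

open scoped Matrix Kronecker ComplexConjugate

noncomputable section

namespace StateMerging

/-! ### States, reduced states, majorization

A finite-dimensional system is `ℂ^X` for a finite index type `X` of its computational basis; a
composite system is indexed by the product type, operators are complex matrices. -/

/-- The operator `|v⟩⟨v|`. -/
def ketBra {X : Type*} (v : X → ℂ) : Matrix X X ℂ :=
  Matrix.vecMulVec v (star v)

/-- Partial trace over the first tensor factor. -/
def traceFst {X Y : Type*} [Fintype X] (ρ : Matrix (X × Y) (X × Y) ℂ) : Matrix Y Y ℂ :=
  fun y y' => ∑ x, ρ (x, y) (x, y')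

/-- Partial trace over the second tensor factor. -/
def traceSnd {X Y : Type*} [Fintype Y] (ρ : Matrix (X × Y) (X × Y) ℂ) : Matrix X X ℂ :=
  fun x x' => ∑ y, ρ (x, y) (x', y)

/-- The reduced state `ψ^R` of `|ψ⟩^{RAB}`. -/
def reducedR {R A B : Type*} [Fintype A] [Fintype B] (ψ : EuclideanSpace ℂ (R × A × B)) :
    Matrix R R ℂ :=
  traceSnd (ketBra ψ)

/-- The reduced state `ψ^{AB}` of `|ψ⟩^{RAB}`. -/
def reducedAB {R A B : Type*} [Fintype R] (ψ : EuclideanSpace ℂ (R × A × B)) :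
    Matrix (A × B) (A × B) ℂ :=
  traceFst (ketBra ψ)

/-- The reduced state `ψ^B` of `|ψ⟩^{RAB}`. -/
def reducedB {R A B : Type*} [Fintype R] [Fintype A] (ψ : EuclideanSpace ℂ (R × A × B)) :
    Matrix B B ℂ :=
  traceFst (reducedAB ψ)

/-- The completely mixed state `𝟙_K / K`. -/
def completelyMixed (K : ℕ) : Matrix (Fin K) (Fin K) ℂ :=
  (K : ℂ)⁻¹ • 1

/-- Majorization `X ≺ Y` of Hermitian operators: `X` is the image of `Y` under a mixed unitary
channel. The operators may act on different spaces; both are then extended by zero to the direct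
sum of the two spaces (that is, their spectra are padded with zeros). -/
def Majorized {m n : Type*} [Fintype m] [DecidableEq m] [Fintype n] [DecidableEq n]
    (X : Matrix m m ℂ) (Y : Matrix n n ℂ) : Prop :=
  ∃ (J : ℕ) (p : Fin J → ℝ) (U : Fin J → Matrix.unitaryGroup (m ⊕ n) ℂ),
    (∀ j, 0 ≤ p j) ∧ ∑ j, p j = 1 ∧
    Matrix.fromBlocks X 0 0 0 =
      ∑ j, (p j : ℂ) • ((U j : Matrix (m ⊕ n) (m ⊕ n) ℂ) * Matrix.fromBlocks 0 0 0 Y *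
        (U j : Matrix (m ⊕ n) (m ⊕ n) ℂ)ᴴ)

/-! ### Local operations and classical communication between two parties -/

/-- A family of measurement operators: finitely many outcomes (sequences of outcomes, when there
have been several rounds), with one operator from `ℂ^P` to `ℂ^Q` for each. -/
structure OpFamily (P Q : Type*) where
  ι : Type
  [fintype : Fintype ι]
  op : ι → Matrix Q P ℂ

attribute [instance] OpFamily.fintype

/-- The completeness condition `∑ₘ Mₘ† Mₘ = 𝟙` of measurement operators. -/
def IsMeasurement {n : ℕ} {X Y : Type*} [Fintype Y] [DecidableEq X]
    (M : Fin n → Matrix Y X ℂ) : Prop :=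
  ∑ m, (M m)ᴴ * M m = 1

/-- The one-element family `{T}`. -/
def OpFamily.single {P Q : Type*} (T : Matrix Q P ℂ) : OpFamily P Q where
  ι := Unit
  op := fun _ => T

/-- `G` is LOCC linked to `F`: one of the two parties performs a measurement on that party's
system, conditioned on all the preceding outcomes `i : F.ι`, and broadcasts the outcome `m`. (The
number `n` of outcomes may be taken independent of `i`, as zero operators are allowed.) -/
def Linked {P X Y : Type*} [Fintype X] [DecidableEq X] [Fintype Y] [DecidableEq Y]
    (F G : OpFamily P (X × Y)) : Prop :=
  ∃ (n : ℕ) (e : G.ι ≃ F.ι × Fin n),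
    (∃ M : F.ι → Fin n → Matrix X X ℂ, (∀ i, IsMeasurement (M i)) ∧
      ∀ g, G.op g = (M (e g).1 (e g).2 ⊗ₖ (1 : Matrix Y Y ℂ)) * F.op (e g).1) ∨
    (∃ M : F.ι → Fin n → Matrix Y Y ℂ, (∀ i, IsMeasurement (M i)) ∧
      ∀ g, G.op g = ((1 : Matrix X X ℂ) ⊗ₖ M (e g).1 (e g).2) * F.op (e g).1)

/-- Final local measurements of both parties, from the working systems `X`, `Y` to the output
systems `A'`, `B'`, conditioned on the broadcast outcomes `i : F.ι`. -/
structure Correction {P X Y : Type*} [DecidableEq X] [DecidableEq Y]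
    (F : OpFamily P (X × Y)) (A' B' : Type*) [Fintype A'] [Fintype B'] where
  nA : ℕ
  nB : ℕ
  opA : F.ι → Fin nA → Matrix A' X ℂ
  opB : F.ι → Fin nB → Matrix B' Y ℂ
  completeA : ∀ i, IsMeasurement (opA i)
  completeB : ∀ i, IsMeasurement (opB i)

/-- The transformation of `ρ` achieved by the non-correcting family `F` followed by the final local
measurements `C`, when all the outcomes are erased. -/
def correctedMap {P X Y A' B' : Type*} [Fintype P] [Fintype X] [DecidableEq X] [Fintype Y]
    [DecidableEq Y] [Fintype A'] [Fintype B'] (F : OpFamily P (X × Y)) (C : Correction F A' B')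
    (ρ : Matrix P P ℂ) : Matrix (A' × B') (A' × B') ℂ :=
  ∑ i, ∑ s, ∑ t,
    ((C.opA i s ⊗ₖ C.opB i t) * F.op i) * ρ * ((C.opA i s ⊗ₖ C.opB i t) * F.op i)ᴴ

/-- LOCC maps from `A`, `B` to `A'`, `B'`. The parties add auxiliary systems by local isometries
`V`, `W`; `F r` is a non-correcting `(r + 1)`-round LOCC linked to the previous one, `C r` the final
local measurements that turn it into an `(r + 1)`-round LOCC, and `E` is the limit for `r → ∞`.
A protocol that stops after finitely many rounds is the case of a sequence of maps that is
eventually constant (the trivial measurement `{𝟙}` being allowed in all further rounds); there is no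
restriction on the direction of the communication in each round. -/
def IsLOCCMap {A B A' B' : Type*} [Fintype A] [DecidableEq A] [Fintype B] [DecidableEq B]
    [Fintype A'] [Fintype B']
    (E : Matrix (A × B) (A × B) ℂ →ₗ[ℂ] Matrix (A' × B') (A' × B') ℂ) : Prop :=
  ∃ (a b : ℕ) (V : Matrix (Fin a) A ℂ) (W : Matrix (Fin b) B ℂ)
    (F : ℕ → OpFamily (A × B) (Fin a × Fin b)) (C : ∀ r, Correction (F r) A' B'),
    Vᴴ * V = 1 ∧ Wᴴ * W = 1 ∧
    Linked (OpFamily.single (V ⊗ₖ W)) (F 0) ∧ (∀ r, Linked (F r) (F (r + 1))) ∧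
    ∀ ρ, Filter.Tendsto (fun r => correctedMap (F r) (C r) ρ) Filter.atTop (nhds (E ρ))

/-- The map `id^R ⊗ E`. -/
def idTensor {P Q : Type*} (R : Type*) (E : Matrix P P ℂ →ₗ[ℂ] Matrix Q Q ℂ)
    (ρ : Matrix (R × P) (R × P) ℂ) : Matrix (R × Q) (R × Q) ℂ :=
  fun x y => E (fun p p' => ρ (x.1, p) (y.1, p')) x.2 y.2

/-! ### Exact state merging -/

/-- The normalized maximally entangled state `|Φ⁺_K⟩ = K^{-1/2} ∑_{l < K} |l⟩ ⊗ |l⟩` in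
`ℂ^a ⊗ ℂ^b`, for `K ≤ a` and `K ≤ b`. -/
def maxEntangled (K a b : ℕ) : Fin a × Fin b → ℂ :=
  fun x => if (x.1 : ℕ) = x.2 ∧ (x.1 : ℕ) < K then ((Real.sqrt K)⁻¹ : ℝ) else 0

/-- `|ψ⟩^{RAB} ⊗ |Φ⁺_K⟩^{A̅B̅}`, where the first party holds `A`, `A̅` and the second
`B`, `B̅`. -/
def initialKet {R A B : Type*} (ψ : EuclideanSpace ℂ (R × A × B)) (K a b : ℕ) :
    R × ((A × Fin a) × (B × Fin b)) → ℂ :=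
  fun x => ψ (x.1, x.2.1.1, x.2.2.1) * maxEntangled K a b (x.2.1.2, x.2.2.2)

/-- `|ψ⟩^{RB'B} ⊗ |Φ⁺_L⟩^{A̅B̅}`, where the first party holds `A̅` and the second
`B'` (a copy of `A`), `B`, `B̅`. -/
def finalKet {R A B : Type*} (ψ : EuclideanSpace ℂ (R × A × B)) (L a b : ℕ) :
    R × (Fin a × ((A × B) × Fin b)) → ℂ :=
  fun x => ψ (x.1, x.2.2.1.1, x.2.2.1.2) * maxEntangled L a b (x.2.1, x.2.2.2)

/-- A protocol for exact state merging of `|ψ⟩^{RAB}`; `a` and `b` are the dimensions of the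
systems `A̅` and `B̅` that hold the maximally entangled states. -/
structure ExactMergingProtocol {R A B : Type*} [Fintype A] [DecidableEq A] [Fintype B]
    [DecidableEq B] (ψ : EuclideanSpace ℂ (R × A × B)) where
  K : ℕ
  L : ℕ
  a : ℕ
  b : ℕ
  K_pos : 0 < K
  L_pos : 0 < L
  K_le_a : K ≤ a
  K_le_b : K ≤ b
  L_le_a : L ≤ a
  L_le_b : L ≤ b
  map : Matrix ((A × Fin a) × (B × Fin b)) ((A × Fin a) × (B × Fin b)) ℂ →ₗ[ℂ]
    Matrix (Fin a × ((A × B) × Fin b)) (Fin a × ((A × B) × Fin b)) ℂ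
  isLOCCMap : IsLOCCMap map
  merges : idTensor R map (ketBra (initialKet ψ K a b)) = ketBra (finalKet ψ L a b)

/-- The entanglement cost `log₂ K - log₂ L`. -/
def ExactMergingProtocol.cost {R A B : Type*} [Fintype A] [DecidableEq A] [Fintype B]
    [DecidableEq B] {ψ : EuclideanSpace ℂ (R × A × B)} (prot : ExactMergingProtocol ψ) : ℝ :=
  Real.logb 2 prot.K - Real.logb 2 prot.L

/-- The non-catalytic setting: `log₂ L = 0`. -/
def ExactMergingProtocol.IsNonCatalytic {R A B : Type*} [Fintype A] [DecidableEq A] [Fintype B]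
    [DecidableEq B] {ψ : EuclideanSpace ℂ (R × A × B)} (prot : ExactMergingProtocol ψ) : Prop :=
  prot.L = 1

/-- `{log₂ K - log₂ L : (𝟙_K / K) ⊗ ψ^B ≺ (𝟙_L / L) ⊗ ψ^{AB}}`. -/
def catalyticCosts {R A B : Type*} [Fintype R] [Fintype A] [DecidableEq A] [Fintype B]
    [DecidableEq B] (ψ : EuclideanSpace ℂ (R × A × B)) : Set ℝ :=
  {c | ∃ K L : ℕ, 0 < K ∧ 0 < L ∧
    Majorized (completelyMixed K ⊗ₖ reducedB ψ) (completelyMixed L ⊗ₖ reducedAB ψ) ∧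
    c = Real.logb 2 K - Real.logb 2 L}

/-- `{log₂ K : (𝟙_K / K) ⊗ ψ^B ≺ ψ^{AB}}`. -/
def nonCatalyticCosts {R A B : Type*} [Fintype R] [Fintype A] [DecidableEq A] [Fintype B]
    [DecidableEq B] (ψ : EuclideanSpace ℂ (R × A × B)) : Set ℝ :=
  {c | ∃ K : ℕ, 0 < K ∧ Majorized (completelyMixed K ⊗ₖ reducedB ψ) (reducedAB ψ) ∧
    c = Real.logb 2 K}

end StateMerging

end

/-! View a ket as its coefficient matrix G in the cut of the second party against reference and
first party. For t ≥ 0 sum max(z − t‖G‖², 0) over the eigenvalues z of GᴴG. This `excess` is the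
maximum of tr(P GᴴG) − t‖G‖² tr P over projections P. A measurement by one party leaves the other
side's reduced state unchanged on average, and the P that is optimal before is admissible for every
outcome, so the mean excess cannot decrease (`entMonotone_le_sum_left`, `entMonotone_le_sum_right`).
Hence it is non-decreasing along every round of an LOCC protocol.

In the limit the averaged output is a pure state, so the weight of the outcomes concentrates on kets
nearly parallel to it. A continuity bound (`entMonotone_le_of_overlap`) then compares the initial
ket with the final one (`entMonotone_le_of_isLOCCMap`). Up to zero eigenvalues the second party's
reduced states are 𝟙_K/K ⊗ ψ^B and 𝟙_L/L ⊗ ψ^{AB}. With equal traces, the excess inequalities for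
all t ≥ 0 say that one spectrum majorizes the other, and Rado's theorem turns this into a mixed
unitary map (`majorized_of_excess_le`). Thus the integers of every protocol are themselves
admissible in the infimum or minimum.

The lower bound on the costs and the corollary use only the top of the spectrum: a mixed unitary map
is unital, so Y ≤ c implies X ≤ c for c ≥ 0. If ψ^R is flat, ψ^{AB} is 1/D times a projection. -/

noncomputable section

namespace StateMerging

open Matrix

section Spectra

/-! ### The trace of the part of a Hermitian operator above a threshold -/

/-- `∑ max (z - s) 0` over the eigenvalues `z` of `ρ`, with multiplicity. -/
def excess {n : Type*} [Fintype n] [DecidableEq n] (s : ℝ) (ρ : Matrix n n ℂ) : ℝ :=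
  (ρ.charpoly.roots.map fun z : ℂ => max (z.re - s) 0).sum

variable {m n l : Type*} [Fintype m] [DecidableEq m] [Fintype n] [DecidableEq n]
  [Fintype l] [DecidableEq l]

/-- The two characteristic polynomials differ by a power of the variable, and a zero root
contributes max(−s, 0) = 0 because s ≥ 0. -/
lemma excess_mul_comm {s : ℝ} (hs : 0 ≤ s) (A : Matrix m n ℂ) (B : Matrix n m ℂ) :
    excess s (A * B) = excess s (B * A) := by
  have h := congrArg (fun p : Polynomial ℂ => (p.roots.map fun z : ℂ => max (z.re - s) 0).sum)
    (charpoly_mul_comm' A B)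
  have hX : ∀ k : ℕ, (Polynomial.X ^ k : Polynomial ℂ) ≠ 0 :=
    fun k => pow_ne_zero _ Polynomial.X_ne_zero
  simp only [Polynomial.roots_mul (mul_ne_zero (hX _) (charpoly_monic _).ne_zero),
    Polynomial.roots_X_pow, Multiset.map_add, Multiset.sum_add, Multiset.map_nsmul,
    Multiset.map_singleton, Multiset.sum_nsmul, Multiset.sum_singleton, Complex.zero_re, zero_sub,
    max_eq_right (neg_nonpos.2 hs), smul_zero, zero_add] at h
  exact h

lemma excess_conj_isometry {s : ℝ} (hs : 0 ≤ s) (E : Matrix m n ℂ) (hE : Eᴴ * E = 1)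
    (X : Matrix n n ℂ) : excess s (E * X * Eᴴ) = excess s X := by
  rw [Matrix.mul_assoc, excess_mul_comm hs, Matrix.mul_assoc, hE, Matrix.mul_one]

lemma excess_eq_sum_eigenvalues {ρ : Matrix n n ℂ} (hρ : ρ.IsHermitian) (s : ℝ) :
    excess s ρ = ∑ i, max (hρ.eigenvalues i - s) 0 := by
  rw [excess, hρ.roots_charpoly_eq_eigenvalues, Multiset.map_map]
  rfl

lemma exists_unitary_diagonal {ρ : Matrix n n ℂ} (hρ : ρ.IsHermitian) :
    ∃ U : Matrix n n ℂ, Uᴴ * U = 1 ∧ U * Uᴴ = 1 ∧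
      ρ = U * diagonal (fun i => (hρ.eigenvalues i : ℂ)) * Uᴴ := by
  refine ⟨hρ.eigenvectorUnitary, Unitary.coe_star_mul_self _, Unitary.coe_mul_star_self _, ?_⟩
  conv_lhs => rw [hρ.spectral_theorem]
  rfl

omit [DecidableEq n] in
lemma diag_projection_mem {P : Matrix n n ℂ} (hP : Pᴴ = P) (hP2 : P * P = P) (i : n) :
    0 ≤ (P i i).re ∧ (P i i).re ≤ 1 := by
  have h1 : (P i i).re = ∑ j, Complex.normSq (P i j) := by
    have h : P i i = ∑ j, P i j * conj (P i j) := by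
      conv_lhs => rw [← hP2, mul_apply]
      refine Finset.sum_congr rfl fun j _ => ?_
      congr 1
      conv_lhs => rw [← hP]
      rfl
    rw [h, Complex.re_sum]
    exact Finset.sum_congr rfl fun j _ => by rw [Complex.mul_conj, Complex.ofReal_re]
  have h2 : (P i i).re * (P i i).re ≤ (P i i).re :=
    calc (P i i).re * (P i i).re ≤ Complex.normSq (P i i) := by
          rw [Complex.normSq_apply]; nlinarith [mul_self_nonneg (P i i).im]
      _ ≤ ∑ j, Complex.normSq (P i j) :=
          Finset.single_le_sum (f := fun j => Complex.normSq (P i j))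
            (fun j _ => Complex.normSq_nonneg _) (Finset.mem_univ i)
      _ = _ := h1.symm
  have h0 : 0 ≤ (P i i).re := h1 ▸ Finset.sum_nonneg fun j _ => Complex.normSq_nonneg _
  exact ⟨h0, by nlinarith⟩

/-- In an eigenbasis of ρ the diagonal entries q of the projection lie in [0, 1], so each term obeys
q(z − s) ≤ max(z − s, 0). With the next lemma this is the variational formula for the excess. -/
lemma trace_projection_sub_le_excess {ρ P : Matrix n n ℂ} (hρ : ρ.IsHermitian) (hP : Pᴴ = P)
    (hP2 : P * P = P) (s : ℝ) :
    (trace (P * ρ)).re - s * (trace P).re ≤ excess s ρ := by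
  obtain ⟨U, hU, hU', h⟩ := exists_unitary_diagonal hρ
  set Q := Uᴴ * P * U with hQ
  have hQ1 : Qᴴ = Q := by
    simp only [hQ, conjTranspose_mul, conjTranspose_conjTranspose, hP, Matrix.mul_assoc]
  have hQ2 : Q * Q = Q := by
    calc Q * Q = Uᴴ * P * (U * Uᴴ) * P * U := by simp only [hQ, Matrix.mul_assoc]
      _ = Uᴴ * (P * P) * U := by rw [hU', Matrix.mul_one]; simp only [Matrix.mul_assoc]
      _ = Q := by rw [hP2]
  have hPt : trace P = trace Q := by
    rw [hQ, trace_mul_comm, ← Matrix.mul_assoc, hU', Matrix.one_mul]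
  have hPρ : trace (P * ρ) = trace (Q * diagonal (fun i => (hρ.eigenvalues i : ℂ))) := by
    calc trace (P * ρ) = trace (P * U * diagonal (fun i => (hρ.eigenvalues i : ℂ)) * Uᴴ) := by
          conv_lhs => rw [h]
          simp only [Matrix.mul_assoc]
      _ = _ := by rw [trace_mul_comm, hQ]; simp only [Matrix.mul_assoc]
  rw [hPt, hPρ, excess_eq_sum_eigenvalues hρ]
  simp only [trace, diag_apply, mul_diagonal, Complex.re_sum, Complex.re_mul_ofReal]
  rw [Finset.mul_sum, ← Finset.sum_sub_distrib]
  refine Finset.sum_le_sum fun i _ => ?_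
  obtain ⟨h0, h1⟩ := diag_projection_mem hQ1 hQ2 i
  have e : (Q i i).re * hρ.eigenvalues i - s * (Q i i).re = (Q i i).re * (hρ.eigenvalues i - s) := by
    ring
  rw [e]
  calc (Q i i).re * (hρ.eigenvalues i - s) ≤ (Q i i).re * max (hρ.eigenvalues i - s) 0 :=
        mul_le_mul_of_nonneg_left (le_max_left _ _) h0
    _ ≤ 1 * max (hρ.eigenvalues i - s) 0 := mul_le_mul_of_nonneg_right h1 (le_max_right _ _)
    _ = _ := one_mul _

lemma exists_projection_excess {ρ : Matrix n n ℂ} (hρ : ρ.IsHermitian) (s : ℝ) :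
    ∃ P : Matrix n n ℂ, Pᴴ = P ∧ P * P = P ∧
      (trace (P * ρ)).re - s * (trace P).re = excess s ρ := by
  obtain ⟨U, hU, hU', h⟩ := exists_unitary_diagonal hρ
  -- The maximizer is the spectral projection onto the eigenvalues above s.
  set c : n → ℂ := fun i => if s < hρ.eigenvalues i then 1 else 0 with hc
  refine ⟨U * diagonal c * Uᴴ, ?_, ?_, ?_⟩
  · have : star c = c := by ext i; simp [hc]
    simp only [conjTranspose_mul, conjTranspose_conjTranspose, diagonal_conjTranspose, this,
      Matrix.mul_assoc]
  · calc U * diagonal c * Uᴴ * (U * diagonal c * Uᴴ)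
        = U * diagonal c * (Uᴴ * U) * diagonal c * Uᴴ := by simp only [Matrix.mul_assoc]
      _ = U * (diagonal c * diagonal c) * Uᴴ := by
          rw [hU, Matrix.mul_one]; simp only [Matrix.mul_assoc]
      _ = U * diagonal c * Uᴴ := by
          rw [diagonal_mul_diagonal]
          congr 3; ext i; simp [hc]
  · have h1 : trace (U * diagonal c * Uᴴ) = ∑ i, c i := by
      rw [trace_mul_comm, ← Matrix.mul_assoc, hU, Matrix.one_mul, trace_diagonal]
    have h2 : trace (U * diagonal c * Uᴴ * ρ) = ∑ i, c i * hρ.eigenvalues i := by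
      have : U * diagonal c * Uᴴ * ρ =
          U * (diagonal c * diagonal (fun i => (hρ.eigenvalues i : ℂ))) * Uᴴ := by
        calc _ = U * diagonal c * Uᴴ * (U * diagonal (fun i => (hρ.eigenvalues i : ℂ)) * Uᴴ) := by
              rw [← h]
          _ = U * diagonal c * (Uᴴ * U) * diagonal (fun i => (hρ.eigenvalues i : ℂ)) * Uᴴ := by
              simp only [Matrix.mul_assoc]
          _ = _ := by rw [hU, Matrix.mul_one]; simp only [Matrix.mul_assoc]
      rw [this, trace_mul_comm, ← Matrix.mul_assoc, hU, Matrix.one_mul, diagonal_mul_diagonal,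
        trace_diagonal]
    rw [h1, h2, excess_eq_sum_eigenvalues hρ, Complex.re_sum, Complex.re_sum, Finset.mul_sum,
      ← Finset.sum_sub_distrib]
    refine Finset.sum_congr rfl fun i _ => ?_
    by_cases hi : s < hρ.eigenvalues i
    · simp [hc, hi, hi.le]
    · simp [hc, hi, not_lt.1 hi]

/-! ### Majorization of spectra -/

omit [DecidableEq n] in
lemma exists_perm_monovary (c y : n → ℝ) : ∃ σ : Equiv.Perm n, Monovary c (y ∘ σ) := by
  let e := Fintype.equivFin n
  let a := Tuple.sort (c ∘ e.symm)
  let b := Tuple.sort (y ∘ e.symm)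
  have ha : Monotone ((c ∘ e.symm) ∘ a) := Tuple.monotone_sort _
  have hb : Monotone ((y ∘ e.symm) ∘ b) := Tuple.monotone_sort _
  refine ⟨e.trans ((a.symm.trans b).trans e.symm), fun i j hij => ?_⟩
  have hi : ∀ i, (y ∘ e.trans ((a.symm.trans b).trans e.symm)) i =
      ((y ∘ e.symm) ∘ b) (a.symm (e i)) := fun i => rfl
  have hi' : ∀ i, c i = ((c ∘ e.symm) ∘ a) (a.symm (e i)) := fun i => by simp
  rw [hi, hi] at hij
  rw [hi' i, hi' j]
  exact ha (hb.reflect_lt hij).le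

-- Layer-cake summation: c i − min c is the integral over s from min c to max c of the indicator of
-- s ≤ c i. Subtracting min c costs nothing because the d i sum to zero.
omit [DecidableEq n] in
lemma sum_mul_nonpos_of_level_sets (c d : n → ℝ) (h0 : ∑ i, d i = 0)
    (h : ∀ s : ℝ, ∑ i with s ≤ c i, d i ≤ 0) : ∑ i, c i * d i ≤ 0 := by
  rcases isEmpty_or_nonempty n with hn | hn
  · simp
  obtain ⟨i₀, -, hi₀⟩ := Finset.univ.exists_min_image c Finset.univ_nonempty
  obtain ⟨i₁, -, hi₁⟩ := Finset.univ.exists_max_image c Finset.univ_nonempty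
  set I := Set.Ioc (c i₀) (c i₁) with hI
  have hint : ∀ i, MeasureTheory.IntegrableOn ((Set.Iic (c i)).indicator fun _ => d i) I :=
    fun i => (MeasureTheory.integrableOn_const (by simp [hI])).indicator measurableSet_Iic
  have hval : ∀ i, ∫ s in I, (Set.Iic (c i)).indicator (fun _ => d i) s =
      (c i - c i₀) * d i := fun i => by
    have hset : I ∩ Set.Iic (c i) = Set.Ioc (c i₀) (c i) := by
      ext s
      simp only [hI, Set.mem_inter_iff, Set.mem_Ioc, Set.mem_Iic]
      have := hi₁ i (Finset.mem_univ i)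
      constructor
      · exact fun h => ⟨h.1.1, h.2⟩
      · exact fun h => ⟨⟨h.1, h.2.trans this⟩, h.2⟩
    rw [MeasureTheory.setIntegral_indicator measurableSet_Iic, hset,
      MeasureTheory.setIntegral_const, Real.volume_real_Ioc_of_le (hi₀ i (Finset.mem_univ i)),
      smul_eq_mul]
  have hsum : ∑ i, c i * d i = ∑ i, (c i - c i₀) * d i := by
    simp only [sub_mul, Finset.sum_sub_distrib, ← Finset.mul_sum, h0, mul_zero, sub_zero]
  rw [hsum, ← Finset.sum_congr rfl fun i _ => hval i,
    ← MeasureTheory.integral_finsetSum _ fun i _ => hint i]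
  refine MeasureTheory.integral_nonpos fun s => ?_
  simp only [Pi.zero_apply]
  refine le_trans (le_of_eq ?_) (h s)
  rw [Finset.sum_filter]
  exact Finset.sum_congr rfl fun i _ => by simp [Set.indicator_apply]

/-- **Rado's theorem**, with majorization expressed by the sums of the excesses over thresholds. -/
lemma mem_convexHull_perm {x y : n → ℝ} (hy : ∀ i, 0 ≤ y i) (hxy : ∑ i, x i = ∑ i, y i)
    (h : ∀ s : ℝ, 0 ≤ s → ∑ i, max (x i - s) 0 ≤ ∑ i, max (y i - s) 0) :
    x ∈ convexHull ℝ (Set.range fun σ : Equiv.Perm n => y ∘ σ) := by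
  by_contra hx
  -- Otherwise a linear functional with coefficients c strictly separates x from all permutations of
  -- y. The permutation ordered like c gives the contradiction.
  obtain ⟨f, u, hf, hu⟩ := geometric_hahn_banach_closed_point (convex_convexHull ℝ _)
    ((Set.finite_range _).isClosed_convexHull ℝ) hx
  set c : n → ℝ := fun i => f (Pi.single i 1) with hc
  have hfc : ∀ z : n → ℝ, f z = ∑ i, c i * z i := fun z => by
    conv_lhs => rw [pi_eq_sum_univ' z]
    simp [hc, mul_comm]
  obtain ⟨σ, hσ⟩ := exists_perm_monovary c y
  have h1 := (hf _ (subset_convexHull ℝ _ ⟨σ, rfl⟩)).trans hu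
  rw [hfc, hfc] at h1
  refine absurd h1 (not_lt.2 ?_)
  rw [← sub_nonpos, ← Finset.sum_sub_distrib]
  simp only [← mul_sub]
  have hs : ∑ i, (y ∘ σ) i = ∑ i, y i := Equiv.sum_comp σ y
  refine sum_mul_nonpos_of_level_sets c _ (by rw [Finset.sum_sub_distrib, hxy, hs, sub_self])
    fun t => ?_
  set T : Finset n := {i | t ≤ c i} with hT
  rcases T.eq_empty_or_nonempty with hE | hE
  · simp [hE]
  obtain ⟨j, hjT, hj⟩ := T.exists_min_image (y ∘ σ) hE
  -- With s the least value of the rearranged y on the level set T, every value off T is at most s.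
  -- So the excess of y at s is exactly the sum of y − s over T, while for x that sum is only a
  -- lower bound of the excess.
  set s := (y ∘ σ) j with hsj
  have hoff : ∀ i ∉ T, (y ∘ σ) i ≤ s := fun i hi => by
    by_contra hlt
    have := hσ (not_le.1 hlt)
    simp only [hT, Finset.mem_filter, Finset.mem_univ, true_and] at hi hjT
    exact hi (hjT.trans this)
  have e1 : ∑ i, max (y i - s) 0 = ∑ i ∈ T, ((y ∘ σ) i - s) := by
    rw [← Equiv.sum_comp σ (fun i => max (y i - s) 0), ← Finset.sum_subset T.subset_univ]
    · exact Finset.sum_congr rfl fun i hi => max_eq_left (sub_nonneg.2 (hj i hi))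
    · exact fun i _ hi => max_eq_right (sub_nonpos.2 (hoff i hi))
  have e2 : ∑ i ∈ T, (x i - s) ≤ ∑ i, max (x i - s) 0 :=
    (Finset.sum_le_sum fun i _ => le_max_left _ _).trans
      (Finset.sum_le_univ_sum_of_nonneg fun i => le_max_right _ _)
  have e3 := e2.trans ((h s (hy _)).trans e1.le)
  rw [Finset.sum_sub_distrib] at e3 ⊢
  rw [Finset.sum_sub_distrib] at e3
  linarith

end Spectra

/-! ### From majorized spectra to mixed unitary maps -/

section MixedUnitary

variable {m n l : Type*} [Fintype m] [DecidableEq m] [Fintype n] [DecidableEq n]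
  [Fintype l] [DecidableEq l]

/-- Two Hermitian matrices with convexly dependent spectra are related by a mixed unitary map. -/
lemma exists_mixedUnitary {X Y : Matrix n n ℂ} (hX : X.IsHermitian) (hY : Y.IsHermitian)
    (h : hX.eigenvalues ∈ convexHull ℝ (Set.range fun σ : Equiv.Perm n => hY.eigenvalues ∘ σ)) :
    ∃ (J : ℕ) (p : Fin J → ℝ) (U : Fin J → unitaryGroup n ℂ),
      (∀ j, 0 ≤ p j) ∧ ∑ j, p j = 1 ∧
      X = ∑ j, (p j : ℂ) • ((U j : Matrix n n ℂ) * Y * (U j : Matrix n n ℂ)ᴴ) := by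
  obtain ⟨ι, _, w, z, hw0, hw1, hz, hwz⟩ := mem_convexHull_iff_exists_fintype.1 h
  choose σ hσ using hz
  obtain ⟨U, hU, hU', hXU⟩ := exists_unitary_diagonal hX
  obtain ⟨V, hV, hV', hYV⟩ := exists_unitary_diagonal hY
  have hP : ∀ i, (σ i).permMatrix ℂ * ((σ i).permMatrix ℂ)ᴴ = 1 := fun i => by
    rw [conjTranspose_permMatrix, ← permMatrix_mul]; simp
  -- This unitary takes the eigenbasis of Y to that of X with the labels permuted, so it conjugates
  -- Y to a matrix diagonal in the eigenbasis of X.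
  have hW : ∀ i, U * (σ i).permMatrix ℂ * Vᴴ ∈ unitaryGroup n ℂ := fun i => by
    rw [mem_unitaryGroup_iff, star_eq_conjTranspose]
    calc _ = U * ((σ i).permMatrix ℂ * (Vᴴ * V) * ((σ i).permMatrix ℂ)ᴴ) * Uᴴ := by
          simp only [conjTranspose_mul, conjTranspose_conjTranspose, Matrix.mul_assoc]
      _ = 1 := by rw [hV, Matrix.mul_one, hP, Matrix.mul_one, hU']
  have hterm : ∀ i, U * (σ i).permMatrix ℂ * Vᴴ * Y * (U * (σ i).permMatrix ℂ * Vᴴ)ᴴ =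
      U * diagonal (fun k => (hY.eigenvalues (σ i k) : ℂ)) * Uᴴ := fun i => by
    calc _ = U * ((σ i).permMatrix ℂ * ((Vᴴ * V) * diagonal (fun k => (hY.eigenvalues k : ℂ)) *
            (Vᴴ * V)) * ((σ i).permMatrix ℂ)ᴴ) * Uᴴ := by
          conv_lhs => rw [hYV]
          simp only [conjTranspose_mul, conjTranspose_conjTranspose, Matrix.mul_assoc]
      _ = _ := by
          rw [hV, Matrix.one_mul, Matrix.mul_one]
          congr 2
          rw [conjTranspose_permMatrix, Equiv.Perm.permMatrix, Equiv.Perm.permMatrix,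
            PEquiv.toMatrix_toPEquiv_mul, PEquiv.mul_toMatrix_toPEquiv]
          ext a b
          have hi : ((σ i)⁻¹).symm = σ i := rfl
          simp [diagonal_apply, hi]
  let e := Fintype.equivFin ι
  refine ⟨Fintype.card ι, w ∘ e.symm, fun j => ⟨_, hW (e.symm j)⟩, fun j => hw0 _, ?_, ?_⟩
  · rw [← hw1]; exact Equiv.sum_comp e.symm w
  · simp only [hterm, Function.comp_apply]
    rw [Equiv.sum_comp e.symm
      fun i => (w i : ℂ) • (U * diagonal (fun k => (hY.eigenvalues (σ i k) : ℂ)) * Uᴴ)]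
    conv_lhs => rw [hXU, ← hwz]
    have : diagonal (fun k => (((∑ i, w i • z i) k : ℝ) : ℂ)) =
        ∑ i, (w i : ℂ) • diagonal (fun k => (hY.eigenvalues (σ i k) : ℂ)) := by
      ext a b
      by_cases hab : a = b
      · subst hab
        simp [Matrix.sum_apply, ← hσ]
      · simp [Matrix.sum_apply, hab]
    rw [this, Matrix.mul_sum, Matrix.sum_mul]
    simp

omit [Fintype n] [DecidableEq n] in
lemma fromBlocks_inl_eq_conj (X : Matrix m m ℂ) :
    (fromBlocks X 0 0 0 : Matrix (m ⊕ n) (m ⊕ n) ℂ) =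
      fromRows (1 : Matrix m m ℂ) 0 * X * (fromRows (1 : Matrix m m ℂ) 0)ᴴ := by
  ext (i | i) (j | j) <;>
    simp [fromRows_mul, conjTranspose_fromRows_eq_fromCols_conjTranspose, mul_fromCols]

omit [Fintype m] [DecidableEq m] in
lemma fromBlocks_inr_eq_conj (Y : Matrix n n ℂ) :
    (fromBlocks 0 0 0 Y : Matrix (m ⊕ n) (m ⊕ n) ℂ) =
      fromRows (0 : Matrix m n ℂ) 1 * Y * (fromRows (0 : Matrix m n ℂ) 1)ᴴ := by
  ext (i | i) (j | j) <;>
    simp [fromRows_mul, conjTranspose_fromRows_eq_fromCols_conjTranspose, mul_fromCols]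

-- Zero padding is conjugation by an isometry, which the excess does not see for s ≥ 0. Since Y ≥ 0,
-- the thresholds that Rado's theorem needs are nonnegative.
open scoped ComplexOrder in
theorem majorized_of_excess_le {X : Matrix m m ℂ} {Y : Matrix n n ℂ} (hX : X.IsHermitian)
    (hY : Y.PosSemidef) (htr : trace X = trace Y)
    (h : ∀ s : ℝ, 0 ≤ s → excess s X ≤ excess s Y) : Majorized X Y := by
  have hXh : (fromBlocks X 0 0 0 : Matrix (m ⊕ n) (m ⊕ n) ℂ).IsHermitian := by
    rw [fromBlocks_inl_eq_conj]; exact isHermitian_mul_mul_conjTranspose _ hX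
  have hYp : (fromBlocks 0 0 0 Y : Matrix (m ⊕ n) (m ⊕ n) ℂ).PosSemidef := by
    rw [fromBlocks_inr_eq_conj]; exact hY.mul_mul_conjTranspose_same _
  refine exists_mixedUnitary hXh hYp.isHermitian
    (mem_convexHull_perm hYp.eigenvalues_nonneg ?_ fun s hs => ?_)
  · have : trace (fromBlocks X 0 0 0 : Matrix (m ⊕ n) (m ⊕ n) ℂ) =
        trace (fromBlocks 0 0 0 Y : Matrix (m ⊕ n) (m ⊕ n) ℂ) := by
      simpa [trace] using htr
    rw [hXh.trace_eq_sum_eigenvalues, hYp.isHermitian.trace_eq_sum_eigenvalues] at this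
    exact_mod_cast this
  · rw [← excess_eq_sum_eigenvalues, ← excess_eq_sum_eigenvalues,
      fromBlocks_inl_eq_conj, fromBlocks_inr_eq_conj, excess_conj_isometry hs,
      excess_conj_isometry hs]
    · exact h s hs
    · simp [conjTranspose_fromRows_eq_fromCols_conjTranspose, fromCols_mul_fromRows]
    · simp [conjTranspose_fromRows_eq_fromCols_conjTranspose, fromCols_mul_fromRows]

end MixedUnitary

section Monotones

variable {m n l : Type*} [Fintype m] [DecidableEq m] [Fintype n] [DecidableEq n]
  [Fintype l] [DecidableEq l]

/-! ### A family of entanglement monotones -/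

/-- The squared Hilbert-Schmidt norm. -/
def normSq (G : Matrix m n ℂ) : ℝ := (trace (Gᴴ * G)).re

/-- An entanglement monotone of the bipartite ket with coefficient matrix `G`: the excess of the
reduced state over the threshold `t`, relative to the weight of the ket. -/
def entMonotone (t : ℝ) (G : Matrix m n ℂ) : ℝ := excess (t * normSq G) (Gᴴ * G)

omit [DecidableEq m] [DecidableEq n] in
lemma normSq_eq_sum (G : Matrix m n ℂ) : normSq G = ∑ i, ∑ j, ‖G i j‖ ^ 2 := by
  rw [Finset.sum_comm, normSq, trace, Complex.re_sum]
  refine Finset.sum_congr rfl fun j _ => ?_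
  rw [diag_apply, mul_apply, Complex.re_sum]
  refine Finset.sum_congr rfl fun i _ => ?_
  rw [conjTranspose_apply, ← Complex.normSq_eq_norm_sq, Complex.star_def, mul_comm,
    Complex.mul_conj, Complex.ofReal_re]

omit [DecidableEq m] [DecidableEq n] in
lemma normSq_nonneg (G : Matrix m n ℂ) : 0 ≤ normSq G := by
  rw [normSq_eq_sum]; positivity

omit [DecidableEq m] [DecidableEq n] in
lemma normSq_conjTranspose (G : Matrix m n ℂ) : normSq Gᴴ = normSq G := by
  rw [normSq, normSq, conjTranspose_conjTranspose, trace_mul_comm]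

/-- The two reduced states of a bipartite ket have the same nonzero spectrum, so the monotone can be
computed on either side. -/
lemma entMonotone_conjTranspose {t : ℝ} (ht : 0 ≤ t) (G : Matrix m n ℂ) :
    entMonotone t Gᴴ = entMonotone t G := by
  rw [entMonotone, entMonotone, normSq_conjTranspose, conjTranspose_conjTranspose,
    excess_mul_comm (mul_nonneg ht (normSq_nonneg G))]

omit [DecidableEq m] in
lemma projection_le_entMonotone (t : ℝ) (G : Matrix m n ℂ) {P : Matrix n n ℂ} (hP : Pᴴ = P)
    (hP2 : P * P = P) :
    (trace (P * (Gᴴ * G))).re - t * normSq G * (trace P).re ≤ entMonotone t G :=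
  trace_projection_sub_le_excess (isHermitian_conjTranspose_mul_self G) hP hP2 _

omit [DecidableEq m] in
lemma exists_projection_entMonotone (t : ℝ) (G : Matrix m n ℂ) :
    ∃ P : Matrix n n ℂ, Pᴴ = P ∧ P * P = P ∧
      (trace (P * (Gᴴ * G))).re - t * normSq G * (trace P).re = entMonotone t G :=
  exists_projection_excess (isHermitian_conjTranspose_mul_self G) _

-- Completeness splits GᴴG, and with it the weight in the threshold, into the sum over the outcomes.
-- The projection optimal for G is admissible in each term.
omit [DecidableEq l] in
lemma entMonotone_le_sum_left {ι : Type*} [Fintype ι] (t : ℝ) (G : Matrix m n ℂ)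
    (M : ι → Matrix l m ℂ) (hM : ∑ i, (M i)ᴴ * M i = 1) :
    entMonotone t G ≤ ∑ i, entMonotone t (M i * G) := by
  obtain ⟨P, hP, hP2, h⟩ := exists_projection_entMonotone t G
  have hG : Gᴴ * G = ∑ i, (M i * G)ᴴ * (M i * G) := by
    calc Gᴴ * G = Gᴴ * (∑ i, (M i)ᴴ * M i) * G := by rw [hM, Matrix.mul_one]
      _ = _ := by
        simp only [Matrix.mul_sum, Matrix.sum_mul, conjTranspose_mul, Matrix.mul_assoc]
  have hn : normSq G = ∑ i, normSq (M i * G) := by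
    rw [normSq, hG, trace_sum, Complex.re_sum]; rfl
  rw [← h, hG, hn, Matrix.mul_sum, trace_sum, Complex.re_sum, Finset.mul_sum, Finset.sum_mul,
    ← Finset.sum_sub_distrib]
  exact Finset.sum_le_sum fun i _ => projection_le_entMonotone t _ hP hP2

lemma entMonotone_le_sum_right {ι : Type*} [Fintype ι] {t : ℝ} (ht : 0 ≤ t) (G : Matrix m n ℂ)
    (N : ι → Matrix n l ℂ) (hN : ∑ i, N i * (N i)ᴴ = 1) :
    entMonotone t G ≤ ∑ i, entMonotone t (G * N i) := by
  rw [← entMonotone_conjTranspose ht]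
  refine (entMonotone_le_sum_left t Gᴴ (fun i => (N i)ᴴ) (by simpa using hN)).trans (le_of_eq ?_)
  exact Finset.sum_congr rfl fun i _ => by rw [← conjTranspose_mul, entMonotone_conjTranspose ht]

/-! ### Continuity of the monotones at a ket -/

section Frobenius

attribute [local instance] Matrix.frobeniusNormedAddCommGroup Matrix.frobeniusNormedSpace

omit [DecidableEq m] [DecidableEq n] in
lemma frobenius_norm_sq (G : Matrix m n ℂ) : ‖G‖ ^ 2 = normSq G := by
  rw [frobenius_norm_def, normSq_eq_sum, ← Real.sqrt_eq_rpow, Real.sq_sqrt (by positivity)]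
  simp

omit [DecidableEq m] [DecidableEq n] in
lemma normSq_mul_projection (G : Matrix m n ℂ) {P : Matrix n n ℂ} (hP : Pᴴ = P)
    (hP2 : P * P = P) : normSq (G * P) = (trace (P * (Gᴴ * G))).re := by
  rw [normSq, conjTranspose_mul, hP, trace_mul_comm, Matrix.mul_assoc G, ← Matrix.mul_assoc P, hP2,
    trace_mul_comm, Matrix.mul_assoc]

omit [DecidableEq m] in
lemma normSq_mul_projection_le (G : Matrix m n ℂ) {P : Matrix n n ℂ} (hP : Pᴴ = P)
    (hP2 : P * P = P) : normSq (G * P) ≤ normSq G := by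
  have hQ : (1 - P)ᴴ = 1 - P := by simp [hP]
  have hQ2 : (1 - P) * (1 - P) = 1 - P := by simp [mul_sub, sub_mul, hP2]
  have h := normSq_nonneg (G * (1 - P))
  rw [normSq_mul_projection G hQ hQ2, Matrix.sub_mul, Matrix.one_mul, trace_sub, Complex.sub_re,
    ← normSq_mul_projection G hP hP2] at h
  exact sub_nonneg.1 h

-- Pythagoras: the subtracted multiple of F is the orthogonal projection of G onto the unit vector
-- F.
omit [DecidableEq m] [DecidableEq n] in
lemma normSq_sub_smul {F : Matrix m n ℂ} (hF : trace (Fᴴ * F) = 1) (G : Matrix m n ℂ) :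
    normSq (G - trace (Fᴴ * G) • F) = normSq G - ‖trace (Fᴴ * G)‖ ^ 2 := by
  have h1 : trace (Gᴴ * F) = conj (trace (Fᴴ * G)) := by
    rw [← Complex.star_def, ← trace_conjTranspose, conjTranspose_mul, conjTranspose_conjTranspose]
  set c := trace (Fᴴ * G) with hc
  have h2 : ‖c‖ ^ 2 = (c * conj c).re := by
    rw [Complex.mul_conj, Complex.ofReal_re, Complex.normSq_eq_norm_sq]
  rw [h2, normSq, normSq, ← Complex.sub_re]
  congr 1
  simp only [conjTranspose_sub, conjTranspose_smul, Matrix.sub_mul, Matrix.mul_sub, trace_sub,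
    Matrix.smul_mul, Matrix.mul_smul, trace_smul, hF, h1, ← hc, Complex.star_def, smul_eq_mul]
  ring

-- Write G = cF + H with H orthogonal to F, and let P be optimal for G. Then ‖GP‖ ≤ |c|‖FP‖ + ‖H‖,
-- and replacing the weight of G by the smaller |c|² only lowers the subtracted term. The errors
-- involve |c| and ‖H‖ alone, with no dimension factor.
omit [DecidableEq m] in
lemma entMonotone_le_of_overlap {t : ℝ} (ht : 0 ≤ t) {F : Matrix m n ℂ} (hF : trace (Fᴴ * F) = 1)
    (G : Matrix m n ℂ) :
    entMonotone t G ≤ ‖trace (Fᴴ * G)‖ ^ 2 * entMonotone t F +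
      2 * (‖trace (Fᴴ * G)‖ * √(normSq G - ‖trace (Fᴴ * G)‖ ^ 2)) +
      (normSq G - ‖trace (Fᴴ * G)‖ ^ 2) := by
  obtain ⟨P, hP, hP2, h⟩ := exists_projection_entMonotone t G
  have hk := normSq_sub_smul hF G
  set c := trace (Fᴴ * G) with hc
  set H := G - c • F with hH
  have hFP : ‖F * P‖ ≤ 1 := by
    have := normSq_mul_projection_le F hP hP2
    rw [← frobenius_norm_sq, normSq, hF, Complex.one_re] at this
    exact (sq_le_one_iff₀ (norm_nonneg _)).1 this
  have hHP : ‖H * P‖ ≤ ‖H‖ := by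
    have := normSq_mul_projection_le H hP hP2
    rw [← frobenius_norm_sq, ← frobenius_norm_sq] at this
    exact (sq_le_sq₀ (norm_nonneg _) (norm_nonneg _)).1 this
  have hGP : ‖G * P‖ ≤ ‖c‖ * ‖F * P‖ + ‖H‖ := by
    have : G * P = c • (F * P) + H * P := by
      rw [hH, Matrix.sub_mul, Matrix.smul_mul]; abel
    rw [this]
    refine (norm_add_le _ _).trans ?_
    rw [norm_smul]
    gcongr
  have hHk : ‖H‖ = √(normSq G - ‖c‖ ^ 2) := by
    rw [← hk, ← frobenius_norm_sq, Real.sqrt_sq (norm_nonneg _)]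
  have hHk2 : normSq G - ‖c‖ ^ 2 = ‖H‖ ^ 2 := by rw [← hk, frobenius_norm_sq]
  have hF1 := projection_le_entMonotone t F hP hP2
  have htP : 0 ≤ (trace P).re := by
    rw [trace, Complex.re_sum]
    exact Finset.sum_nonneg fun i _ => (diag_projection_mem hP hP2 i).1
  rw [← normSq_mul_projection F hP hP2, ← frobenius_norm_sq, normSq, hF, Complex.one_re,
    mul_one] at hF1
  rw [← h, ← normSq_mul_projection G hP hP2, ← frobenius_norm_sq, ← hHk, hHk2]
  have hsq : ‖G * P‖ ^ 2 ≤ ‖c‖ ^ 2 * ‖F * P‖ ^ 2 + 2 * (‖c‖ * ‖H‖) + ‖H‖ ^ 2 := by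
    calc ‖G * P‖ ^ 2 ≤ (‖c‖ * ‖F * P‖ + ‖H‖) ^ 2 := by gcongr
      _ = ‖c‖ ^ 2 * ‖F * P‖ ^ 2 + 2 * (‖c‖ * ‖H‖) * ‖F * P‖ + ‖H‖ ^ 2 := by ring
      _ ≤ _ := by
        have : 2 * (‖c‖ * ‖H‖) * ‖F * P‖ ≤ 2 * (‖c‖ * ‖H‖) * 1 := by gcongr
        linarith
  have h2 := mul_le_mul_of_nonneg_left hF1 (sq_nonneg ‖c‖)
  have h3 : t * ‖c‖ ^ 2 * (trace P).re ≤ t * normSq G * (trace P).re := by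
    have : ‖c‖ ^ 2 ≤ normSq G := sub_nonneg.1 (hHk2 ▸ sq_nonneg _)
    gcongr
  linarith

end Frobenius

omit [DecidableEq m] in
open Filter Topology in
/-- If the members of ensembles of kets with asymptotic weight one become parallel to the unit ket
`F`, then the mean monotone is asymptotically at most that of `F`. -/
lemma le_entMonotone_of_tendsto {t : ℝ} (ht : 0 ≤ t) {F : Matrix m n ℂ} (hF : trace (Fᴴ * F) = 1)
    {ι : ℕ → Type*} [∀ r, Fintype (ι r)] (G : ∀ r, ι r → Matrix m n ℂ)
    (h1 : Tendsto (fun r => ∑ i, ‖trace (Fᴴ * G r i)‖ ^ 2) atTop (𝓝 1))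
    (h2 : Tendsto (fun r => ∑ i, normSq (G r i)) atTop (𝓝 1)) {C : ℝ}
    (hC : ∀ r, C ≤ ∑ i, entMonotone t (G r i)) : C ≤ entMonotone t F := by
  have h3 : Tendsto (fun r => ∑ i, (normSq (G r i) - ‖trace (Fᴴ * G r i)‖ ^ 2)) atTop (𝓝 0) := by
    simpa only [Finset.sum_sub_distrib, sub_self] using h2.sub h1
  have hlim := ((h1.mul_const (entMonotone t F)).add
    (((h1.sqrt).mul (h3.sqrt)).const_mul 2)).add h3
  simp only [Real.sqrt_zero, mul_zero, add_zero, one_mul] at hlim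
  refine ge_of_tendsto' hlim fun r => (hC r).trans ?_
  refine (Finset.sum_le_sum fun i _ => entMonotone_le_of_overlap ht hF (G r i)).trans ?_
  rw [Finset.sum_add_distrib, Finset.sum_add_distrib, ← Finset.sum_mul, ← Finset.mul_sum]
  gcongr
  have hk : ∀ i, 0 ≤ normSq (G r i) - ‖trace (Fᴴ * G r i)‖ ^ 2 := fun i => by
    rw [← normSq_sub_smul hF]; exact normSq_nonneg _
  -- Cauchy–Schwarz over the outcomes keeps the cross terms free of the number of outcomes, which
  -- may grow with r.
  refine (Real.sum_mul_le_sqrt_mul_sqrt _ _ _).trans (le_of_eq ?_)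
  simp only [Real.sq_sqrt (hk _)]

end Monotones

section Operations

variable {R A B P Q S X Y X' Y' Z : Type*}

/-! ### Kets and local operations -/

/-- The ket `(𝟙^R ⊗ T) |v⟩`. -/
def applyOp [Fintype P] (T : Matrix Q P ℂ) (v : R × P → ℂ) : R × Q → ℂ :=
  fun z => ∑ p, T z.2 p * v (z.1, p)

/-- The coefficient matrix of a ket in the bipartition of the second party against the rest. -/
def ketMatrix (v : R × (X × Y) → ℂ) : Matrix Y (R × X) ℂ :=
  fun y z => v (z.1, (z.2, y))

lemma applyOp_mul [Fintype P] [Fintype Q] (T : Matrix S Q ℂ) (T' : Matrix Q P ℂ)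
    (v : R × P → ℂ) : applyOp (T * T') v = applyOp T (applyOp T' v) := by
  ext z
  simp only [applyOp, mul_apply, Finset.sum_mul, Finset.mul_sum]
  rw [Finset.sum_comm]
  simp only [mul_assoc]

lemma ketMatrix_applyOp_kronecker [Fintype R] [DecidableEq R] [Fintype X] [Fintype Y]
    (M : Matrix X' X ℂ) (N : Matrix Y' Y ℂ) (v : R × (X × Y) → ℂ) :
    ketMatrix (applyOp (M ⊗ₖ N) v) =
      N * ketMatrix v * ((1 : Matrix R R ℂ) ⊗ₖ M)ᵀ := by
  ext y z
  simp only [ketMatrix, applyOp, mul_apply, kroneckerMap_apply, transpose_apply,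
    Fintype.sum_prod_type, Finset.sum_mul]
  rw [Finset.sum_eq_single z.1 (fun r _ hr => by simp [one_apply_ne hr.symm])
    (fun h => absurd (Finset.mem_univ _) h)]
  refine Finset.sum_congr rfl fun x _ => Finset.sum_congr rfl fun y' _ => ?_
  rw [one_apply_eq]; ring

/-- The operator `⟨r| (|v⟩⟨v|) |r'⟩` for basis states `r`, `r'` of the reference. -/
def ketBraBlock (v : R × P → ℂ) (r r' : R) : Matrix P P ℂ :=
  fun p p' => ketBra v (r, p) (r', p')

lemma ketBra_applyOp [Fintype P] (T : Matrix Q P ℂ) (v : R × P → ℂ) (x y : R × Q) :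
    ketBra (applyOp T v) x y =
      (T * ketBraBlock v x.1 y.1 * Tᴴ) x.2 y.2 := by
  simp only [ketBraBlock, ketBra, vecMulVec_apply, applyOp, Pi.star_apply, star_sum, star_mul', mul_apply,
    conjTranspose_apply, Finset.sum_mul, Finset.mul_sum]
  refine Finset.sum_congr rfl fun p _ => Finset.sum_congr rfl fun p' _ => ?_
  ring

/-! ### Behaviour of the monotones under rounds of measurements -/

section Monotone

variable [Fintype R] [DecidableEq R] [Fintype X] [DecidableEq X] [Fintype Y] [DecidableEq Y]
  [Fintype X'] [DecidableEq X'] [Fintype Y'] [DecidableEq Y'] [Fintype P]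

/-- The first party's operators multiply the coefficient matrix on the right as transposes, so their
completeness becomes the condition ∑ N Nᴴ = 1. -/
lemma entMonotone_le_sum_fst {t : ℝ} (ht : 0 ≤ t) {n : ℕ} {M : Fin n → Matrix X' X ℂ}
    (hM : IsMeasurement M) (v : R × (X × Y) → ℂ) :
    entMonotone t (ketMatrix v) ≤
      ∑ k, entMonotone t (ketMatrix (applyOp (M k ⊗ₖ (1 : Matrix Y Y ℂ)) v)) := by
  simp only [ketMatrix_applyOp_kronecker, Matrix.one_mul]
  refine entMonotone_le_sum_right ht _ _ ?_
  have h : ∀ k, ((1 : Matrix R R ℂ) ⊗ₖ M k)ᵀ * (((1 : Matrix R R ℂ) ⊗ₖ M k)ᵀ)ᴴ =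
      ((1 : Matrix R R ℂ) ⊗ₖ ((M k)ᴴ * M k))ᵀ := fun k => by
    have hT : ((1 : Matrix R R ℂ) ⊗ₖ M k)ᵀᴴ = ((1 : Matrix R R ℂ) ⊗ₖ M k)ᴴᵀ := rfl
    rw [hT, ← transpose_mul, conjTranspose_kronecker, ← mul_kronecker_mul, conjTranspose_one,
      Matrix.one_mul]
  simp only [h]
  have hs : ∑ k, (1 : Matrix R R ℂ) ⊗ₖ ((M k)ᴴ * M k) =
      (1 : Matrix R R ℂ) ⊗ₖ ∑ k, (M k)ᴴ * M k :=
    (map_sum (kroneckerBilinear (R := ℂ) (1 : Matrix R R ℂ)) _ _).symm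
  rw [← transpose_sum, hs, hM, one_kronecker_one, transpose_one]

omit [DecidableEq Y'] in
lemma entMonotone_le_sum_snd (t : ℝ) {n : ℕ} {N : Fin n → Matrix Y' Y ℂ}
    (hN : IsMeasurement N) (v : R × (X × Y) → ℂ) :
    entMonotone t (ketMatrix v) ≤
      ∑ k, entMonotone t (ketMatrix (applyOp ((1 : Matrix X X ℂ) ⊗ₖ N k) v)) := by
  simp only [ketMatrix_applyOp_kronecker, one_kronecker_one, transpose_one, Matrix.mul_one]
  exact entMonotone_le_sum_left t _ _ hN

/-- The mean of the monotone over the outcomes of `F`. -/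
def OpFamily.mean (t : ℝ) (F : OpFamily P (X × Y)) (v : R × P → ℂ) : ℝ :=
  ∑ i, entMonotone t (ketMatrix (applyOp (F.op i) v))

lemma mean_le_of_linked {t : ℝ} (ht : 0 ≤ t) {F G : OpFamily P (X × Y)} (h : Linked F G)
    (v : R × P → ℂ) : F.mean t v ≤ G.mean t v := by
  obtain ⟨n, e, ⟨M, hM, hG⟩ | ⟨M, hM, hG⟩⟩ := h
  · have : G.mean t v = ∑ i, ∑ k, entMonotone t (ketMatrix
        (applyOp (M i k ⊗ₖ (1 : Matrix Y Y ℂ)) (applyOp (F.op i) v))) := by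
      rw [OpFamily.mean, ← Fintype.sum_prod_type', ← Equiv.sum_comp e]
      exact Finset.sum_congr rfl fun g _ => by rw [hG, applyOp_mul]
    rw [this]
    exact Finset.sum_le_sum fun i _ => entMonotone_le_sum_fst ht (hM i) _
  · have : G.mean t v = ∑ i, ∑ k, entMonotone t (ketMatrix
        (applyOp ((1 : Matrix X X ℂ) ⊗ₖ M i k) (applyOp (F.op i) v))) := by
      rw [OpFamily.mean, ← Fintype.sum_prod_type', ← Equiv.sum_comp e]
      exact Finset.sum_congr rfl fun g _ => by rw [hG, applyOp_mul]
    rw [this]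
    exact Finset.sum_le_sum fun i _ => entMonotone_le_sum_snd t (hM i) _

/-- The Kraus operators of a corrected map. -/
def Correction.kraus {F : OpFamily P (X × Y)} (C : Correction F X' Y')
    (g : F.ι × Fin C.nA × Fin C.nB) : Matrix (X' × Y') P ℂ :=
  (C.opA g.1 g.2.1 ⊗ₖ C.opB g.1 g.2.2) * F.op g.1

-- The final product measurement is two successive local measurements.
omit [DecidableEq Y'] in
lemma mean_le_sum_kraus {t : ℝ} (ht : 0 ≤ t) {F : OpFamily P (X × Y)} (C : Correction F X' Y')
    (v : R × P → ℂ) :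
    F.mean t v ≤ ∑ g, entMonotone t (ketMatrix (applyOp (C.kraus g) v)) := by
  simp only [Fintype.sum_prod_type]
  refine Finset.sum_le_sum fun i _ => ?_
  refine (entMonotone_le_sum_fst ht (C.completeA i) _).trans (Finset.sum_le_sum fun s _ => ?_)
  refine (entMonotone_le_sum_snd t (C.completeB i) _).trans (le_of_eq ?_)
  refine Finset.sum_congr rfl fun k _ => ?_
  rw [← applyOp_mul, ← applyOp_mul, ← mul_kronecker_mul, Matrix.one_mul, Matrix.mul_one]
  rfl

omit [Fintype R] [DecidableEq R] [DecidableEq X'] [DecidableEq Y'] in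
lemma correctedMap_ketBra [DecidableEq P] {F : OpFamily P (X × Y)} (C : Correction F X' Y')
    (v : R × P → ℂ) (x y : R × (X' × Y')) :
    correctedMap F C (ketBraBlock v x.1 y.1) x.2 y.2 =
      ∑ g, ketBra (applyOp (C.kraus g) v) x y := by
  simp only [correctedMap, Matrix.sum_apply, Fintype.sum_prod_type, ketBra_applyOp]
  rfl

end Monotone

/-- A local isometry is a measurement with one outcome. -/
lemma entMonotone_le_single [Fintype R] [DecidableEq R] [Fintype A] [DecidableEq A] [Fintype B]
    [DecidableEq B] [Fintype X] [DecidableEq X] [Fintype Y] [DecidableEq Y] {t : ℝ} (ht : 0 ≤ t)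
    {V : Matrix X A ℂ} {W : Matrix Y B ℂ} (hV : Vᴴ * V = 1) (hW : Wᴴ * W = 1)
    (v : R × (A × B) → ℂ) :
    entMonotone t (ketMatrix v) ≤ (OpFamily.single (V ⊗ₖ W)).mean t v := by
  have hV' : IsMeasurement (fun _ : Fin 1 => V) := by simpa [IsMeasurement] using hV
  have hW' : IsMeasurement (fun _ : Fin 1 => W) := by simpa [IsMeasurement] using hW
  refine (entMonotone_le_sum_fst ht hV' v).trans ?_
  rw [Fin.sum_univ_one]
  refine (entMonotone_le_sum_snd t hW' _).trans (le_of_eq ?_)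
  rw [Fin.sum_univ_one, ← applyOp_mul, ← mul_kronecker_mul, Matrix.one_mul, Matrix.mul_one]
  exact (Fintype.sum_unique (ι := Unit)
    fun _ => entMonotone t (ketMatrix (applyOp (V ⊗ₖ W) v))).symm

/-! ### Ensembles whose average converges to a pure state -/

section Limit

variable [Fintype R] [Fintype X] [Fintype Y]

lemma trace_ketMatrix (f g : R × (X × Y) → ℂ) :
    trace ((ketMatrix f)ᴴ * ketMatrix g) = ∑ x, star (f x) * g x := by
  simp only [trace, diag_apply, mul_apply, conjTranspose_apply, ketMatrix, Fintype.sum_prod_type]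

lemma normSq_ketMatrix (g : R × (X × Y) → ℂ) :
    normSq (ketMatrix g) = (∑ x, ketBra g x x).re := by
  rw [normSq, trace_ketMatrix]
  simp only [ketBra, vecMulVec_apply, Pi.star_apply, mul_comm]

lemma overlap_ketMatrix (f g : R × (X × Y) → ℂ) :
    ‖trace ((ketMatrix f)ᴴ * ketMatrix g)‖ ^ 2 =
      (∑ x, ∑ y, star (f x) * ketBra g x y * f y).re := by
  rw [← Complex.normSq_eq_norm_sq, ← Complex.ofReal_re (Complex.normSq _), ← Complex.mul_conj,
    trace_ketMatrix, map_sum, Finset.sum_mul_sum]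
  simp only [ketBra, vecMulVec_apply, Pi.star_apply, map_mul, Complex.star_def, Complex.conj_conj]
  congr 1
  exact Finset.sum_congr rfl fun x _ => Finset.sum_congr rfl fun y _ => by ring

-- Total weight and total squared overlap with f are linear in the averaged operator, so its
-- entrywise convergence to the pure state of f forces both to tend to 1.
open Filter Topology in
lemma le_entMonotone_of_tendsto_ketBra [DecidableEq R] [DecidableEq X] [DecidableEq Y] {t : ℝ}
    (ht : 0 ≤ t) {f : R × (X × Y) → ℂ} (hf : ∑ x, star (f x) * f x = 1)
    {ι : ℕ → Type*} [∀ r, Fintype (ι r)] (g : ∀ r, ι r → R × (X × Y) → ℂ)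
    (hg : ∀ x y, Tendsto (fun r => ∑ i, ketBra (g r i) x y) atTop (𝓝 (ketBra f x y))) {C : ℝ}
    (hC : ∀ r, C ≤ ∑ i, entMonotone t (ketMatrix (g r i))) :
    C ≤ entMonotone t (ketMatrix f) := by
  have hF : trace ((ketMatrix f)ᴴ * ketMatrix f) = 1 := by rw [trace_ketMatrix, hf]
  refine le_entMonotone_of_tendsto ht hF (fun r i => ketMatrix (g r i)) ?_ ?_ hC
  · have h1 : ‖trace ((ketMatrix f)ᴴ * ketMatrix f)‖ ^ 2 = 1 := by simp [hF]
    rw [← h1]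
    simp only [overlap_ketMatrix]
    have h2 : Tendsto (fun r => ∑ x, ∑ y, star (f x) * (∑ i, ketBra (g r i) x y) * f y) atTop
        (𝓝 (∑ x, ∑ y, star (f x) * ketBra f x y * f y)) :=
      tendsto_finsetSum _ fun x _ => tendsto_finsetSum _ fun y _ =>
        ((hg x y).const_mul (star (f x))).mul_const (f y)
    refine ((Complex.continuous_re.tendsto _).comp h2).congr fun r => ?_
    simp only [Function.comp_apply, Finset.mul_sum, Finset.sum_mul, Complex.re_sum]
    rw [Finset.sum_congr rfl fun x _ => Finset.sum_comm, Finset.sum_comm]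
  · have h1 : normSq (ketMatrix f) = 1 := by rw [normSq, hF, Complex.one_re]
    rw [← h1]
    simp only [normSq_ketMatrix]
    have h2 : Tendsto (fun r => ∑ x, ∑ i, ketBra (g r i) x x) atTop (𝓝 (∑ x, ketBra f x x)) :=
      tendsto_finsetSum _ fun x _ => hg x x
    refine ((Complex.continuous_re.tendsto _).comp h2).congr fun r => ?_
    rw [Function.comp_apply, Finset.sum_comm, Complex.re_sum]

end Limit

/-- The monotones do not decrease when an LOCC map transforms a ket into a unit ket. -/
theorem entMonotone_le_of_isLOCCMap [Fintype R] [DecidableEq R] [Fintype A] [DecidableEq A]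
    [Fintype B] [DecidableEq B] [Fintype X'] [DecidableEq X'] [Fintype Y'] [DecidableEq Y']
    {E : Matrix (A × B) (A × B) ℂ →ₗ[ℂ] Matrix (X' × Y') (X' × Y') ℂ} (hE : IsLOCCMap E)
    {v : R × (A × B) → ℂ} {f : R × (X' × Y') → ℂ} (hf : ∑ x, star (f x) * f x = 1)
    (h : idTensor R E (ketBra v) = ketBra f) {t : ℝ} (ht : 0 ≤ t) :
    entMonotone t (ketMatrix v) ≤ entMonotone t (ketMatrix f) := by
  obtain ⟨a, b, V, W, F, C, hV, hW, hF0, hF, hlim⟩ := hE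
  refine le_entMonotone_of_tendsto_ketBra ht hf (fun r g => applyOp ((C r).kraus g) v)
    (fun x y => ?_) fun r => ?_
  · rw [← h]
    simp only [← correctedMap_ketBra]
    exact ((continuous_apply_apply x.2 y.2).tendsto _).comp (hlim _)
  · refine (entMonotone_le_single ht hV hW v).trans (le_trans ?_ (mean_le_sum_kraus ht (C r) v))
    induction r with
    | zero => exact mean_le_of_linked ht hF0 v
    | succ r ih => exact ih.trans (mean_le_of_linked ht (hF r) v)

end Operations

section States

variable {m n R A B Z : Type*}

/-! ### Reduced states of the initial and the final ket -/

/-- The isometry consists of the columns of the identity selected by f; conjugation with it is zero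
padding. -/
lemma exists_isometry_submatrix [Fintype n] [DecidableEq n] [DecidableEq m] [Fintype m]
    (T : Matrix m m ℂ) {f : n → m} (hf : f.Injective)
    (hT : ∀ i j, (i ∉ Set.range f ∨ j ∉ Set.range f) → T i j = 0) :
    ∃ E : Matrix m n ℂ, Eᴴ * E = 1 ∧ T = E * T.submatrix f f * Eᴴ := by
  refine ⟨of fun i k => (1 : Matrix m m ℂ) i (f k), ?_, ?_⟩
  · ext k l
    simp [mul_apply, one_apply, hf.eq_iff, eq_comm]
  · have h0 : ∀ i ∉ Set.range f, ∀ k, (1 : Matrix m m ℂ) i (f k) = 0 :=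
      fun i hi k => one_apply_ne fun h => hi ⟨k, h.symm⟩
    ext i j
    simp only [mul_apply, submatrix_apply, of_apply, conjTranspose_apply]
    by_cases hi : i ∈ Set.range f
    · by_cases hj : j ∈ Set.range f
      · obtain ⟨k, rfl⟩ := hi
        obtain ⟨l, rfl⟩ := hj
        simp [one_apply, hf.eq_iff]
      · rw [hT i j (Or.inr hj)]
        simp [h0 j hj]
    · rw [hT i j (Or.inl hi)]
      simp [h0 i hi]

lemma exists_isometry_completelyMixed [Fintype Z] [DecidableEq Z] {K b : ℕ} (hK : K ≤ b)
    (H : Matrix Z Z ℂ) {T : Matrix (Z × Fin b) (Z × Fin b) ℂ}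
    (hT : ∀ x y, T x y = H x.1 y.1 * if x.2 = y.2 ∧ (x.2 : ℕ) < K then (K : ℂ)⁻¹ else 0) :
    ∃ E : Matrix (Z × Fin b) (Fin K × Z) ℂ,
      Eᴴ * E = 1 ∧ T = E * (completelyMixed K ⊗ₖ H) * Eᴴ := by
  have hf : (fun x : Fin K × Z => (x.2, Fin.castLE hK x.1)).Injective := by
    rintro ⟨k, z⟩ ⟨k', z'⟩ h
    simp only [Prod.mk.injEq, Fin.castLE_inj] at h ⊢
    exact h.symm
  have hr : ∀ x : Z × Fin b, x ∉ Set.range (fun x : Fin K × Z => (x.2, Fin.castLE hK x.1)) →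
      ¬ (x.2 : ℕ) < K := fun x hx h => hx ⟨(⟨x.2, h⟩, x.1), rfl⟩
  obtain ⟨E, hE, h⟩ := exists_isometry_submatrix T hf fun x y hxy => by
    rw [hT, if_neg, mul_zero]
    rintro ⟨h1, h2⟩
    exact hxy.elim (fun hx => hr x hx h2) fun hy => hr y hy (h1 ▸ h2)
  refine ⟨E, hE, ?_⟩
  rw [h]
  congr 2
  ext x y
  by_cases hxy : x.1 = y.1 <;>
    simp [hT, completelyMixed, one_apply, hxy, mul_comm]

/-- Removes the trivial one-dimensional factor left in the non-catalytic case. -/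
lemma exists_isometry_completelyMixed_one [Fintype Z] [DecidableEq Z] (H : Matrix Z Z ℂ) :
    ∃ E : Matrix (Fin 1 × Z) Z ℂ, Eᴴ * E = 1 ∧ completelyMixed 1 ⊗ₖ H = E * H * Eᴴ := by
  obtain ⟨E, hE, h⟩ := exists_isometry_submatrix (completelyMixed 1 ⊗ₖ H)
    (f := fun z : Z => ((0 : Fin 1), z)) (Prod.mk_right_injective _) fun x y hxy => by
      have hx : ∀ x : Fin 1 × Z, x ∈ Set.range fun z : Z => ((0 : Fin 1), z) :=
        fun x => ⟨x.2, Prod.ext (Subsingleton.elim _ _) rfl⟩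
      exact absurd hxy (by simp only [hx, not_true, or_self, not_false_iff])
  refine ⟨E, hE, h.trans ?_⟩
  congr 2
  ext x y
  simp [completelyMixed]

lemma entMonotone_eq_excess [Fintype m] [DecidableEq m] [Fintype n] [DecidableEq n] [Fintype Z]
    [DecidableEq Z] {t : ℝ} (ht : 0 ≤ t) {G : Matrix m n ℂ} {E : Matrix m Z ℂ} {X : Matrix Z Z ℂ}
    (hE : Eᴴ * E = 1) (h : G * Gᴴ = E * X * Eᴴ) (hX : trace X = 1) :
    entMonotone t G = excess t X := by
  have hn : normSq Gᴴ = 1 := by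
    rw [normSq, conjTranspose_conjTranspose, h, trace_mul_comm, ← Matrix.mul_assoc, hE,
      Matrix.one_mul, hX, Complex.one_re]
  rw [← entMonotone_conjTranspose ht, entMonotone, hn, mul_one, conjTranspose_conjTranspose, h,
    excess_conj_isometry ht E hE]

lemma sum_maxEntangled {K a : ℕ} (b : ℕ) (hK : K ≤ a) (j j' : Fin b) :
    ∑ i : Fin a, maxEntangled K a b (i, j) * star (maxEntangled K a b (i, j')) =
      if j = j' ∧ (j : ℕ) < K then (K : ℂ)⁻¹ else 0 := by
  by_cases hj : (j : ℕ) < K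
  -- Only the index equal to j contributes; it exists in the first factor because j < K ≤ a.
  · rw [Finset.sum_eq_single ⟨j, hj.trans_le hK⟩]
    · by_cases hjj : j = j'
      · subst hjj
        simp only [maxEntangled, hj, and_self, if_true, Complex.star_def, Complex.conj_ofReal]
        rw [← Complex.ofReal_mul, ← mul_inv, Real.mul_self_sqrt (Nat.cast_nonneg K)]
        simp
      · have : ¬ (j : ℕ) = j' := fun h => hjj (Fin.ext h)
        simp [maxEntangled, hjj, this]
    · intro i _ hi
      have : ¬ (i : ℕ) = j := fun h => hi (Fin.ext h)
      simp [maxEntangled, this]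
    · exact fun h => absurd (Finset.mem_univ _) h
  · rw [if_neg fun h => hj h.2]
    refine Finset.sum_eq_zero fun i _ => ?_
    have : ¬ ((i : ℕ) = j ∧ (i : ℕ) < K) := fun h => hj (h.1 ▸ h.2)
    simp [maxEntangled, this]

variable [Fintype R] [Fintype A] [Fintype B]

omit [Fintype B] in
lemma ketMatrix_initialKet_mul (ψ : EuclideanSpace ℂ (R × A × B)) {K a : ℕ} (b : ℕ) (hK : K ≤ a)
    (x y : B × Fin b) :
    (ketMatrix (initialKet ψ K a b) * (ketMatrix (initialKet ψ K a b))ᴴ) x y =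
      reducedB ψ x.1 y.1 * if x.2 = y.2 ∧ (x.2 : ℕ) < K then (K : ℂ)⁻¹ else 0 := by
  rw [← sum_maxEntangled b hK]
  simp only [mul_apply, conjTranspose_apply, ketMatrix, initialKet, reducedB, reducedAB, traceFst,
    ketBra, vecMulVec_apply, Pi.star_apply, star_mul', Fintype.sum_prod_type]
  rw [Finset.sum_comm, Finset.sum_mul]
  refine Finset.sum_congr rfl fun _ _ => ?_
  rw [Finset.sum_mul_sum]
  refine Finset.sum_congr rfl fun _ _ => Finset.sum_congr rfl fun _ _ => ?_
  ring

omit [Fintype A] [Fintype B] in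
lemma ketMatrix_finalKet_mul (ψ : EuclideanSpace ℂ (R × A × B)) {L a : ℕ} (b : ℕ) (hL : L ≤ a)
    (x y : (A × B) × Fin b) :
    (ketMatrix (finalKet ψ L a b) * (ketMatrix (finalKet ψ L a b))ᴴ) x y =
      reducedAB ψ x.1 y.1 * if x.2 = y.2 ∧ (x.2 : ℕ) < L then (L : ℂ)⁻¹ else 0 := by
  rw [← sum_maxEntangled b hL]
  simp only [mul_apply, conjTranspose_apply, ketMatrix, finalKet, reducedAB, traceFst,
    ketBra, vecMulVec_apply, Pi.star_apply, star_mul', Fintype.sum_prod_type]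
  rw [Finset.sum_mul_sum]
  refine Finset.sum_congr rfl fun _ _ => Finset.sum_congr rfl fun _ _ => ?_
  ring

lemma sum_star_mul_self {ψ : EuclideanSpace ℂ (R × A × B)} (hψ : ‖ψ‖ = 1) :
    ∑ r, ∑ a, ∑ b, ψ (r, a, b) * star (ψ (r, a, b)) = 1 := by
  have h := EuclideanSpace.norm_sq_eq ψ
  rw [hψ, one_pow] at h
  simp only [Complex.star_def, Complex.mul_conj, Complex.normSq_eq_norm_sq]
  simp only [Fintype.sum_prod_type] at h
  exact_mod_cast h.symm

lemma trace_reducedAB {ψ : EuclideanSpace ℂ (R × A × B)} (hψ : ‖ψ‖ = 1) :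
    trace (reducedAB ψ) = 1 := by
  rw [← sum_star_mul_self hψ]
  simp only [trace, diag_apply, reducedAB, traceFst, ketBra, vecMulVec_apply, Pi.star_apply]
  rw [Finset.sum_comm]
  simp only [Fintype.sum_prod_type]

lemma trace_reducedB {ψ : EuclideanSpace ℂ (R × A × B)} (hψ : ‖ψ‖ = 1) :
    trace (reducedB ψ) = 1 := by
  rw [← trace_reducedAB hψ]
  simp only [trace, diag_apply, reducedB, traceFst, Fintype.sum_prod_type]
  rw [Finset.sum_comm]

lemma trace_reducedR {ψ : EuclideanSpace ℂ (R × A × B)} (hψ : ‖ψ‖ = 1) :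
    trace (reducedR ψ) = 1 := by
  rw [← sum_star_mul_self hψ]
  simp only [trace, diag_apply, reducedR, traceSnd, ketBra, vecMulVec_apply, Pi.star_apply,
    Fintype.sum_prod_type]

lemma trace_completelyMixed_kronecker {K : ℕ} (hK : 0 < K) [Fintype Z] {H : Matrix Z Z ℂ}
    (hH : trace H = 1) : trace (completelyMixed K ⊗ₖ H) = 1 := by
  have : (K : ℂ) ≠ 0 := Nat.cast_ne_zero.2 hK.ne'
  rw [trace_kronecker, hH, mul_one, completelyMixed, trace_smul, trace_one, Fintype.card_fin,
    smul_eq_mul, inv_mul_cancel₀ this]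

/-- The coefficient matrix of `|ψ⟩` in the bipartition of `AB` against `R`. -/
def coeffMatrix (ψ : EuclideanSpace ℂ (R × A × B)) : Matrix (A × B) R ℂ :=
  of fun x r => ψ (r, x)

omit [Fintype A] [Fintype B] in
lemma reducedAB_eq_mul (ψ : EuclideanSpace ℂ (R × A × B)) :
    reducedAB ψ = coeffMatrix ψ * (coeffMatrix ψ)ᴴ := by
  ext x y
  simp [coeffMatrix, reducedAB, traceFst, ketBra, vecMulVec_apply, mul_apply]

omit [Fintype R] in
lemma reducedR_transpose_eq_mul (ψ : EuclideanSpace ℂ (R × A × B)) :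
    (reducedR ψ)ᵀ = (coeffMatrix ψ)ᴴ * coeffMatrix ψ := by
  ext x y
  simp [coeffMatrix, reducedR, traceSnd, ketBra, vecMulVec_apply, mul_apply, mul_comm]

/-! ### Majorization forced by a merging protocol, and its consequences -/

section Order

open scoped ComplexOrder

lemma posSemidef_reducedAB (ψ : EuclideanSpace ℂ (R × A × B)) : (reducedAB ψ).PosSemidef := by
  rw [reducedAB_eq_mul]
  exact posSemidef_self_mul_conjTranspose _

omit [Fintype B] in
lemma isHermitian_reducedB (ψ : EuclideanSpace ℂ (R × A × B)) : (reducedB ψ).IsHermitian := by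
  ext x y
  simp [reducedB, reducedAB, traceFst, ketBra, vecMulVec_apply, mul_comm]

lemma posSemidef_completelyMixed (K : ℕ) : (completelyMixed K).PosSemidef := by
  have h : (0 : ℂ) ≤ (K : ℂ)⁻¹ := inv_nonneg.2 (Nat.cast_nonneg K)
  exact PosSemidef.one.smul h

/-- Both sides are monotones of normalized kets: G Gᴴ is the second party's reduced state, supported
on the first K (after merging, L) levels of its auxiliary system. -/
theorem excess_le_of_protocol [DecidableEq R] [DecidableEq A] [DecidableEq B]
    {ψ : EuclideanSpace ℂ (R × A × B)} (hψ : ‖ψ‖ = 1) (prot : ExactMergingProtocol ψ) {t : ℝ}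
    (ht : 0 ≤ t) :
    excess t (completelyMixed prot.K ⊗ₖ reducedB ψ) ≤
      excess t (completelyMixed prot.L ⊗ₖ reducedAB ψ) := by
  obtain ⟨E, hE, hi⟩ := exists_isometry_completelyMixed prot.K_le_b _
    (ketMatrix_initialKet_mul ψ prot.b prot.K_le_a)
  obtain ⟨E', hE', hf⟩ := exists_isometry_completelyMixed prot.L_le_b _
    (ketMatrix_finalKet_mul ψ prot.b prot.L_le_a)
  have h1 := trace_completelyMixed_kronecker prot.K_pos (trace_reducedB hψ)
  have h2 := trace_completelyMixed_kronecker prot.L_pos (trace_reducedAB hψ)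
  rw [← entMonotone_eq_excess ht hE hi h1, ← entMonotone_eq_excess ht hE' hf h2]
  refine entMonotone_le_of_isLOCCMap prot.isLOCCMap ?_ prot.merges ht
  rw [← trace_ketMatrix, trace_mul_comm, hf, trace_mul_comm, ← Matrix.mul_assoc, hE',
    Matrix.one_mul, h2]

theorem majorized_of_protocol [DecidableEq R] [DecidableEq A] [DecidableEq B]
    {ψ : EuclideanSpace ℂ (R × A × B)} (hψ : ‖ψ‖ = 1) (prot : ExactMergingProtocol ψ) :
    Majorized (completelyMixed prot.K ⊗ₖ reducedB ψ) (completelyMixed prot.L ⊗ₖ reducedAB ψ) := by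
  refine majorized_of_excess_le ?_ ((posSemidef_completelyMixed _).kronecker
    (posSemidef_reducedAB ψ)) ?_ fun s hs => excess_le_of_protocol hψ prot hs
  · rw [IsHermitian, conjTranspose_kronecker, (posSemidef_completelyMixed _).isHermitian.eq,
      (isHermitian_reducedB ψ).eq]
  · rw [trace_completelyMixed_kronecker prot.K_pos (trace_reducedB hψ),
      trace_completelyMixed_kronecker prot.L_pos (trace_reducedAB hψ)]

theorem majorized_of_nonCatalytic [DecidableEq R] [DecidableEq A] [DecidableEq B]
    {ψ : EuclideanSpace ℂ (R × A × B)} (hψ : ‖ψ‖ = 1) (prot : ExactMergingProtocol ψ)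
    (hL : prot.IsNonCatalytic) :
    Majorized (completelyMixed prot.K ⊗ₖ reducedB ψ) (reducedAB ψ) := by
  refine majorized_of_excess_le ?_ (posSemidef_reducedAB ψ) ?_ fun s hs => ?_
  · rw [IsHermitian, conjTranspose_kronecker, (posSemidef_completelyMixed _).isHermitian.eq,
      (isHermitian_reducedB ψ).eq]
  · rw [trace_completelyMixed_kronecker prot.K_pos (trace_reducedB hψ), trace_reducedAB hψ]
  · have h := excess_le_of_protocol hψ prot hs
    rw [show prot.L = 1 from hL] at h
    obtain ⟨E, hE, hE'⟩ := exists_isometry_completelyMixed_one (reducedAB ψ)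
    rwa [hE', excess_conj_isometry hs E hE] at h

/-! ### Bounds on the largest eigenvalue -/

/-- Mixed unitary maps are unital, so they carry c − Y on the direct sum to c − X. The padded block
of c − Y is c times the identity, whence c ≥ 0; the bound on X is read off a principal block. -/
lemma posSemidef_sub_of_majorized [Fintype m] [DecidableEq m] [Fintype n] [DecidableEq n]
    {X : Matrix m m ℂ} {Y : Matrix n n ℂ} (h : Majorized X Y) {c : ℝ} (hc : 0 ≤ c)
    (hY : ((c : ℂ) • (1 : Matrix n n ℂ) - Y).PosSemidef) :
    ((c : ℂ) • (1 : Matrix m m ℂ) - X).PosSemidef := by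
  obtain ⟨J, p, U, hp, hp1, h⟩ := h
  have hc' : (0 : ℂ) ≤ c := by exact_mod_cast hc
  have hY' : ((c : ℂ) • (1 : Matrix (m ⊕ n) (m ⊕ n) ℂ) - fromBlocks 0 0 0 Y).PosSemidef := by
    have : (c : ℂ) • (1 : Matrix (m ⊕ n) (m ⊕ n) ℂ) - fromBlocks 0 0 0 Y =
        fromBlocks ((c : ℂ) • 1) 0 0 0 + fromBlocks 0 0 0 ((c : ℂ) • 1 - Y) := by
      rw [← fromBlocks_one, fromBlocks_smul, fromBlocks_add]
      ext (i | i) (j | j) <;> simp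
    rw [this, fromBlocks_inl_eq_conj, fromBlocks_inr_eq_conj]
    exact ((PosSemidef.one.smul hc').mul_mul_conjTranspose_same _).add
      (hY.mul_mul_conjTranspose_same _)
  have hsum : (c : ℂ) • (1 : Matrix (m ⊕ n) (m ⊕ n) ℂ) - fromBlocks X 0 0 0 =
      ∑ j, (p j : ℂ) • ((U j : Matrix (m ⊕ n) (m ⊕ n) ℂ) *
        ((c : ℂ) • (1 : Matrix (m ⊕ n) (m ⊕ n) ℂ) - fromBlocks 0 0 0 Y) *
        (U j : Matrix (m ⊕ n) (m ⊕ n) ℂ)ᴴ) := by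
    have hU : ∀ j, (U j : Matrix (m ⊕ n) (m ⊕ n) ℂ) * (U j : Matrix (m ⊕ n) (m ⊕ n) ℂ)ᴴ = 1 :=
      fun j => Unitary.coe_mul_star_self (U j)
    have hp1' : ∑ j, (p j : ℂ) = 1 := by exact_mod_cast hp1
    simp only [Matrix.mul_sub, Matrix.sub_mul, Matrix.mul_smul, Matrix.smul_mul, Matrix.mul_one, hU,
      smul_sub, Finset.sum_sub_distrib, ← h, ← Finset.sum_smul, hp1', one_smul]
  have hX' : ((c : ℂ) • (1 : Matrix (m ⊕ n) (m ⊕ n) ℂ) - fromBlocks X 0 0 0).PosSemidef := by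
    rw [hsum]
    exact posSemidef_sum _ fun j _ =>
      (hY'.mul_mul_conjTranspose_same _).smul (by exact_mod_cast hp j)
  convert hX'.submatrix Sum.inl using 1
  ext i j
  simp [one_apply]

lemma posSemidef_sub_completelyMixed_kronecker [Fintype Z] [DecidableEq Z] {H : Matrix Z Z ℂ}
    {d : ℝ} (h : ((d : ℂ) • (1 : Matrix Z Z ℂ) - H).PosSemidef) (L : ℕ) :
    (((d / L : ℝ) : ℂ) • (1 : Matrix (Fin L × Z) (Fin L × Z) ℂ) -
      completelyMixed L ⊗ₖ H).PosSemidef := by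
  have e : ((d / L : ℝ) : ℂ) • (1 : Matrix (Fin L × Z) (Fin L × Z) ℂ) - completelyMixed L ⊗ₖ H =
      completelyMixed L ⊗ₖ ((d : ℂ) • (1 : Matrix Z Z ℂ) - H) := by
    ext x y
    by_cases h1 : x.1 = y.1 <;> by_cases h2 : x.2 = y.2 <;>
      simp [completelyMixed, one_apply, Prod.ext_iff, h1, h2]
    ring
  rw [e]
  exact (posSemidef_completelyMixed L).kronecker h

lemma posSemidef_sub_of_completelyMixed_kronecker [Fintype Z] [DecidableEq Z] {H : Matrix Z Z ℂ}
    {c : ℝ} {K : ℕ} (hK : 0 < K) (h : ((c : ℂ) • (1 : Matrix (Fin K × Z) (Fin K × Z) ℂ) -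
      completelyMixed K ⊗ₖ H).PosSemidef) :
    (((c * K : ℝ) : ℂ) • (1 : Matrix Z Z ℂ) - H).PosSemidef := by
  have hK' : (K : ℂ) ≠ 0 := Nat.cast_ne_zero.2 hK.ne'
  have hK0 : (0 : ℂ) ≤ K := Nat.cast_nonneg K
  convert (h.submatrix fun z : Z => ((⟨0, hK⟩ : Fin K), z)).smul hK0 using 1
  ext x y
  by_cases h2 : x = y <;>
    simp [completelyMixed, one_apply, h2, hK', mul_sub, mul_comm (c : ℂ)]

/-- If `(𝟙_K / K) ⊗ H ≺ (𝟙_L / L) ⊗ ρ` and `ρ ≤ d`, then `H ≤ d K / L`. -/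
lemma posSemidef_sub_of_majorized_kronecker [Fintype m] [DecidableEq m] [Fintype n] [DecidableEq n]
    {H : Matrix m m ℂ} {ρ : Matrix n n ℂ} {K L : ℕ} (hK : 0 < K)
    (h : Majorized (completelyMixed K ⊗ₖ H) (completelyMixed L ⊗ₖ ρ)) {d : ℝ} (hd : 0 ≤ d)
    (hρ : ((d : ℂ) • (1 : Matrix n n ℂ) - ρ).PosSemidef) :
    (((d / L * K : ℝ) : ℂ) • (1 : Matrix m m ℂ) - H).PosSemidef :=
  posSemidef_sub_of_completelyMixed_kronecker hK (posSemidef_sub_of_majorized h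
    (div_nonneg hd (Nat.cast_nonneg L)) (posSemidef_sub_completelyMixed_kronecker hρ L))

lemma exists_posSemidef_sub [Fintype n] [DecidableEq n] {ρ : Matrix n n ℂ} (hρ : ρ.IsHermitian) :
    ∃ d : ℝ, 0 < d ∧ ((d : ℂ) • (1 : Matrix n n ℂ) - ρ).PosSemidef := by
  obtain ⟨U, hU, hU', h⟩ := exists_unitary_diagonal hρ
  -- A crude bound on the spectrum; the 1 makes it strictly positive.
  refine ⟨1 + ∑ i, |hρ.eigenvalues i|, by positivity, ?_⟩
  set d := 1 + ∑ i, |hρ.eigenvalues i| with hd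
  have : (d : ℂ) • (1 : Matrix n n ℂ) - ρ =
      U * diagonal (fun i => ((d - hρ.eigenvalues i : ℝ) : ℂ)) * Uᴴ := by
    have : diagonal (fun i => ((d - hρ.eigenvalues i : ℝ) : ℂ)) =
        (d : ℂ) • (1 : Matrix n n ℂ) - diagonal (fun i => (hρ.eigenvalues i : ℂ)) := by
      ext i j; by_cases hij : i = j <;> simp [hij]
    rw [this, Matrix.mul_sub, Matrix.sub_mul, ← h, Matrix.mul_smul, Matrix.smul_mul, Matrix.mul_one,
      hU']
  rw [this]
  refine (PosSemidef.diagonal (Pi.le_def.2 fun i => ?_)).mul_mul_conjTranspose_same _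
  have h1 : |hρ.eigenvalues i| ≤ ∑ i, |hρ.eigenvalues i| :=
    Finset.single_le_sum (f := fun i => |hρ.eigenvalues i|) (fun i _ => abs_nonneg _)
      (Finset.mem_univ i)
  have h2 : 0 ≤ d - hρ.eigenvalues i := by
    have := le_abs_self (hρ.eigenvalues i)
    rw [hd]; linarith
  exact Complex.zero_le_real.2 h2

lemma eigenvalue_le_of_posSemidef_sub [Fintype n] [DecidableEq n] {H : Matrix n n ℂ} {c lam : ℝ}
    (h : ((c : ℂ) • (1 : Matrix n n ℂ) - H).PosSemidef)
    (hlam : Module.End.HasEigenvalue (toLin' H) (lam : ℂ)) : lam ≤ c := by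
  obtain ⟨v, hv, hv0⟩ := hlam.exists_hasEigenvector
  rw [Module.End.mem_eigenspace_iff, toLin'_apply] at hv
  have h1 := h.dotProduct_mulVec_nonneg v
  rw [sub_mulVec, hv, smul_mulVec, one_mulVec, ← sub_smul, dotProduct_smul, smul_eq_mul] at h1
  have h2 : 0 < star v ⬝ᵥ v := dotProduct_star_self_pos_iff.2 hv0
  have h3 := (Complex.nonneg_iff.1 h1).1
  rw [← Complex.ofReal_sub, Complex.re_ofReal_mul] at h3
  exact sub_nonneg.1 (nonneg_of_mul_nonneg_left h3 (Complex.pos_iff.1 h2).1)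

lemma exists_eigenvalue_pos [Fintype n] [DecidableEq n] {H : Matrix n n ℂ} (hH : H.IsHermitian)
    (htr : trace H = 1) :
    ∃ t : ℝ, 0 < t ∧ Module.End.HasEigenvalue (toLin' H) (t : ℂ) := by
  rw [hH.trace_eq_sum_eigenvalues] at htr
  have h1 : ∑ i, hH.eigenvalues i = 1 := by simpa using congrArg Complex.re htr
  obtain ⟨i, -, hi⟩ := Finset.exists_lt_of_sum_lt (s := Finset.univ) (f := fun _ => (0 : ℝ))
    (g := hH.eigenvalues) (by simp [h1])
  refine ⟨_, hi, ?_⟩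
  rw [Module.End.hasEigenvalue_iff_mem_spectrum, spectrum_toLin']
  rw [hH.spectrum_eq_image_range]
  exact ⟨_, ⟨i, rfl⟩, rfl⟩

/-- Flatness of ψ^R gives ρ² = ρ/D for ρ = ψ^{AB}. Then Q = 1/D − ρ satisfies Q² = Q/D, so Q = D Q
Qᴴ ≥ 0. -/
lemma posSemidef_sub_reducedAB [DecidableEq R] [DecidableEq A]
    [DecidableEq B] {ψ : EuclideanSpace ℂ (R × A × B)} {D : ℕ} (hD : 0 < D)
    (h : reducedR ψ = (D : ℂ)⁻¹ • (1 : Matrix R R ℂ)) :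
    ((((D : ℝ)⁻¹ : ℝ) : ℂ) • (1 : Matrix (A × B) (A × B) ℂ) - reducedAB ψ).PosSemidef := by
  have hR : (coeffMatrix ψ)ᴴ * coeffMatrix ψ = (D : ℂ)⁻¹ • (1 : Matrix R R ℂ) := by
    rw [← reducedR_transpose_eq_mul, h, transpose_smul, transpose_one]
  have hsq : reducedAB ψ * reducedAB ψ = (D : ℂ)⁻¹ • reducedAB ψ := by
    calc reducedAB ψ * reducedAB ψ =
          coeffMatrix ψ * ((coeffMatrix ψ)ᴴ * coeffMatrix ψ) * (coeffMatrix ψ)ᴴ := by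
          rw [reducedAB_eq_mul]; simp only [Matrix.mul_assoc]
      _ = _ := by rw [hR, Matrix.mul_smul, Matrix.mul_one, Matrix.smul_mul, reducedAB_eq_mul]
  have hD' : (D : ℂ) ≠ 0 := Nat.cast_ne_zero.2 hD.ne'
  have hD0 : (0 : ℂ) ≤ D := Nat.cast_nonneg D
  set Q := (D : ℂ)⁻¹ • (1 : Matrix (A × B) (A × B) ℂ) - reducedAB ψ with hQ
  have hQh : Qᴴ = Q := by
    simp [hQ, (posSemidef_reducedAB ψ).isHermitian.eq]
  have hQ2 : Q = (D : ℂ) • (Q * Qᴴ) := by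
    rw [hQh, hQ]
    simp only [Matrix.sub_mul, Matrix.mul_sub, Matrix.smul_mul, Matrix.mul_smul, Matrix.one_mul,
      Matrix.mul_one, hsq, sub_self, sub_zero, smul_sub, smul_smul]
    rw [← mul_assoc, mul_inv_cancel₀ hD', one_mul, one_smul]
  have : (((D : ℝ)⁻¹ : ℝ) : ℂ) = (D : ℂ)⁻¹ := by push_cast; rfl
  rw [this, ← hQ, hQ2]
  exact (posSemidef_self_mul_conjTranspose _).smul hD0

/-! ### Bounds on the entanglement cost -/

variable [DecidableEq A] [DecidableEq B]

lemma bddBelow_catalyticCosts {ψ : EuclideanSpace ℂ (R × A × B)} (hψ : ‖ψ‖ = 1) :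
    BddBelow (catalyticCosts ψ) := by
  obtain ⟨d, hd, hρ⟩ := exists_posSemidef_sub (posSemidef_reducedAB ψ).isHermitian
  obtain ⟨t, ht, hev⟩ := exists_eigenvalue_pos (isHermitian_reducedB ψ) (trace_reducedB hψ)
  -- Any positive eigenvalue t of ψ^B and any d ≥ ψ^{AB} satisfy t ≤ dK/L.
  refine ⟨Real.logb 2 (t / d), ?_⟩
  rintro _ ⟨K, L, hK, hL, hmaj, rfl⟩
  have hK' : (0 : ℝ) < K := Nat.cast_pos.2 hK
  have hL' : (0 : ℝ) < L := Nat.cast_pos.2 hL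
  have h := eigenvalue_le_of_posSemidef_sub
    (posSemidef_sub_of_majorized_kronecker hK hmaj hd.le hρ) hev
  rw [← Real.logb_div hK'.ne' hL'.ne']
  refine Real.logb_le_logb_of_le one_lt_two (by positivity) ?_
  rw [div_le_iff₀ hd]
  calc t ≤ d / L * K := h
    _ = K / L * d := by ring

lemma isLeast_nonCatalyticCosts {ψ : EuclideanSpace ℂ (R × A × B)}
    (hne : (nonCatalyticCosts ψ).Nonempty) :
    IsLeast (nonCatalyticCosts ψ) (sInf (nonCatalyticCosts ψ)) := by
  classical
  obtain ⟨_, K₀, hK₀, hmaj₀, -⟩ := hne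
  have hex : ∃ K : ℕ, 0 < K ∧ Majorized (completelyMixed K ⊗ₖ reducedB ψ) (reducedAB ψ) :=
    ⟨K₀, hK₀, hmaj₀⟩
  obtain ⟨hpos, hmaj⟩ := Nat.find_spec hex
  have hleast : IsLeast (nonCatalyticCosts ψ) (Real.logb 2 (Nat.find hex : ℕ)) := by
    refine ⟨⟨_, hpos, hmaj, rfl⟩, ?_⟩
    rintro _ ⟨K, hK, hKm, rfl⟩
    exact Real.logb_le_logb_of_le one_lt_two (Nat.cast_pos.2 hpos)
      (Nat.cast_le.2 (Nat.find_min' hex ⟨hK, hKm⟩))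
  rwa [hleast.csInf_eq]

/-- For a maximally mixed reference, the largest eigenvalue of `ψ^B` bounds the ratio of the ranks
of the maximally entangled states. -/
lemma eigenvalue_mul_le_of_protocol [DecidableEq R] {ψ : EuclideanSpace ℂ (R × A × B)}
    (hψ : ‖ψ‖ = 1) {D : ℕ} {lam : ℝ} (hR : reducedR ψ = (D : ℂ)⁻¹ • (1 : Matrix R R ℂ))
    (hlam : IsGreatest {t : ℝ | Module.End.HasEigenvalue (toLin' (reducedB ψ)) (t : ℂ)} lam)
    (prot : ExactMergingProtocol ψ) : 0 < lam * D ∧ lam * D ≤ prot.K / prot.L := by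
  -- For D = 0 the convention 0⁻¹ = 0 would make ψ^R vanish, against its unit trace.
  have hD : 0 < D := by
    rcases Nat.eq_zero_or_pos D with rfl | h
    · have := trace_reducedR hψ
      simp [hR] at this
    · exact h
  have hD' : (0 : ℝ) < D := Nat.cast_pos.2 hD
  obtain ⟨t, ht, hev⟩ := exists_eigenvalue_pos (isHermitian_reducedB ψ) (trace_reducedB hψ)
  refine ⟨mul_pos (ht.trans_le (hlam.2 hev)) hD', ?_⟩
  have h := eigenvalue_le_of_posSemidef_sub (posSemidef_sub_of_majorized_kronecker prot.K_pos
    (majorized_of_protocol hψ prot) (inv_nonneg.2 hD'.le) (posSemidef_sub_reducedAB hD hR)) hlam.1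
  rw [← le_div_iff₀ hD']
  calc lam ≤ (D : ℝ)⁻¹ / prot.L * prot.K := h
    _ = prot.K / prot.L / D := by ring

end Order

end States

end StateMerging

end

theorem mainTheorem4 {R A B : Type*} [Fintype R] [DecidableEq R] [Fintype A] [DecidableEq A]
    [Fintype B] [DecidableEq B] (ψ : EuclideanSpace ℂ (R × A × B)) (hψ : ‖ψ‖ = 1) :
    (∀ prot : StateMerging.ExactMergingProtocol ψ,
      IsGLB (StateMerging.catalyticCosts ψ) (sInf (StateMerging.catalyticCosts ψ)) ∧
      sInf (StateMerging.catalyticCosts ψ) ≤ prot.cost) ∧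
    (∀ prot : StateMerging.ExactMergingProtocol ψ, prot.IsNonCatalytic →
      IsLeast (StateMerging.nonCatalyticCosts ψ) (sInf (StateMerging.nonCatalyticCosts ψ)) ∧
      sInf (StateMerging.nonCatalyticCosts ψ) ≤ Real.logb 2 prot.K) ∧
    (∀ (D : ℕ) (lam : ℝ), StateMerging.reducedR ψ = (D : ℂ)⁻¹ • (1 : Matrix R R ℂ) →
      IsGreatest {t : ℝ | Module.End.HasEigenvalue
        (Matrix.toLin' (StateMerging.reducedB ψ)) (t : ℂ)} lam →
      (∀ prot : StateMerging.ExactMergingProtocol ψ, Real.logb 2 (lam * D) ≤ prot.cost) ∧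
      (∀ prot : StateMerging.ExactMergingProtocol ψ, prot.IsNonCatalytic →
        Real.logb 2 (⌈lam * D⌉₊ : ℕ) ≤ Real.logb 2 prot.K)) := by
  refine ⟨fun prot => ?_, fun prot hL => ?_, fun D lam hR hlam => ⟨fun prot => ?_, fun prot hL => ?_⟩⟩
  -- The protocol's own K and L are admissible, which also shows that the set is non-empty.
  · have hmem : prot.cost ∈ StateMerging.catalyticCosts ψ :=
      ⟨prot.K, prot.L, prot.K_pos, prot.L_pos, StateMerging.majorized_of_protocol hψ prot, rfl⟩
    have hbdd := StateMerging.bddBelow_catalyticCosts hψ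
    exact ⟨isGLB_csInf ⟨_, hmem⟩ hbdd, csInf_le hbdd hmem⟩
  · have hmem : Real.logb 2 prot.K ∈ StateMerging.nonCatalyticCosts ψ :=
      ⟨prot.K, prot.K_pos, StateMerging.majorized_of_nonCatalytic hψ prot hL, rfl⟩
    have hleast := StateMerging.isLeast_nonCatalyticCosts ⟨_, hmem⟩
    exact ⟨hleast, hleast.2 hmem⟩
  · obtain ⟨h0, h⟩ := StateMerging.eigenvalue_mul_le_of_protocol hψ hR hlam prot
    rw [StateMerging.ExactMergingProtocol.cost, ← Real.logb_div
      (Nat.cast_ne_zero.2 prot.K_pos.ne') (Nat.cast_ne_zero.2 prot.L_pos.ne')]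
    exact Real.logb_le_logb_of_le one_lt_two h0 h
  · obtain ⟨h0, h⟩ := StateMerging.eigenvalue_mul_le_of_protocol hψ hR hlam prot
    rw [show prot.L = 1 from hL, Nat.cast_one, div_one] at h
    -- As K is an integer, λD ≤ K already gives ⌈λD⌉ ≤ K.
    exact Real.logb_le_logb_of_le one_lt_two (Nat.cast_pos.2 (Nat.ceil_pos.2 h0))
      (Nat.cast_le.2 (Nat.ceil_le.2 h))
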